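/- **Setting.** Let $N\in\mathbb N_0$, $\mathcal N=\{1,\dots,N\}$, and consider $\dot x_i=f_i(x,u_i)$, $u_i=g_i(x+e)$, $i\in\mathcal N$, with $x=(x_1,\dots,x_N)$, $x_i,e_i\in\mathbb R^{n_i}$, $u_i\in\mathbb R^{m_i}$, all $f_i$ continuous and all $g_i$ locally bounded (not necessarily continuous). Let $Z(j)$ be the set of $i\in\mathcal N$ such that $g_i$ depends explicitly on $x_j$. $\mathcal K_\infty$ is the set of continuous, strictly increasing, unbounded $\alpha:\mathbb R_+\to\mathbb R_+$ with $\alpha(0)=0$; $\alpha:\mathbb R_+\to\mathbb R_+$ is positive definite if $\alpha(r)=0\Leftrightarrow r=0$. A continuous $\mu:\mathbb R_+^{m}\to\mathbb R_+$ is a monotone aggregation function ($\mu\in\mathrm{MAF}_m$) if $\mu(v)>0$ for $v\neq0$, $\mu(v)>\mu(z)$ whenever $v_k>z_k$ for all $k$, and $\mu(v)\to\infty$ as $\|v\|\to\infty$. **Assumption 1.** There are differentiable $V_i:\mathbb R^{n_i}\to\mathbb R_+$, $\alpha_{i1},\alpha_{i2}\in\mathcal K_\infty$ with $\alpha_{i1}(\|x_i\|)\le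 V_i(x_i)\le\alpha_{i2}(\|x_i\|)$, functions $\mu_i\in\mathrm{MAF}_{2N}$, $\gamma_{ij},\eta_{ij}\in\mathcal K_\infty\cup\{0\}$ with $\gamma_{ii}=0$ and $\eta_{ij}\ne0\Leftrightarrow i\in Z(j)$, and positive definite $\alpha_i$ such that for all $x,e$ $$V_i(x_i)\ge\mu_i\big(\gamma_{i1}(V_1(x_1)),\dots,\gamma_{iN}(V_N(x_N)),\eta_{i1}(\|e_1\|),\dots,\eta_{iN}(\|e_N\|)\big)\ \Rightarrow\ \nabla V_i(x_i)f_i(x,g_i(x+e))\le-\alpha_i(\|x_i\|).$$ **Assumption 2.** There are $\sigma\in\mathcal K_\infty^N$ and $\varphi_{ij}\in\mathcal K_\infty\cup\{0\}$, with $\varphi_{ij}\neq0$ whenever $\eta_{ij}\ne0$, such that $\sigma$ is an $\Omega$-path, i.e. each $\sigma_i^{-1}$ is locally Lipschitz on $(0,\infty)$; for every compact $K\subset(0,\infty)$ there are $0<c<C$ with $c\le(\sigma_i^{-1})'(r)\le C$ for all $i$ and all points of differentiability $r\in K$; and $\mu_i(\gamma_{i1}(\sigma_1(r)),\dots,\gamma_{iN}(\sigma_N(r)),0,\dots,0)<\sigma_i(r)$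 for all $r>0$ and $i$; and moreover, for all $r>0$ and $i$, $$\mu_i\big(\gamma_{i1}(\sigma_1(r)),\dots,\gamma_{iN}(\sigma_N(r)),\varphi_{i1}(r),\dots,\varphi_{iN}(r)\big)<\sigma_i(r).$$ **Triggering.** Put $\chi_j=\sigma_j\circ\max_{i\in Z(j)}\varphi_{ij}^{-1}\circ\eta_{ij}$ (with $\max_\emptyset=0$) and $T_i(x_i,e_i)=\chi_i(\|e_i\|)-V_i(x_i)$. A solution of the event-triggered closed loop $\dot x_i=f_i(x,g_i(\hat x))$, $e=\hat x-x$, starts at $t_0=0$ with $e=0$; $\hat x$ is constant between events; from $t_k$ on, the flow with $\hat x$ fixed (a non-extendable solution of the ODE) is followed up to $t_{k+1}=\inf\{t>t_k:\exists i,\ T_i(x_i(t),e_i(t))\ge0\text{ and }e_i(t)\neq0\}$ ($t_{k+1}=\infty$ if this set is empty), at which those systems $i$ satisfying the condition reset $\hat x_i$ to $x_i$. (The clause $e_i\ne0$ only says that a system staying at $x_i=0$ does not transmit again.) The solution is Zeno if the times $t_k$ converge to a finite limit. **Theorem.** Let Assumptions 1 and 2 hold. Then the origin is a globally uniformly asymptotically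 stable equilibrium for the non-Zeno solutions of the event-triggered closed loop (hence for all solutions if no Zeno behavior is induced). That is, all non-Zeno solutions exist for all $t\ge0$; those with $x(0)=0$ stay at $0$; and, uniformly over all non-Zeno solutions and all $t_0\ge0$: for every $\varepsilon>0$ there is $\delta>0$ such that $\|x(t_0)\|\le\delta$ implies $\|x(t)\|\le\varepsilon$ for all $t\ge t_0$; for every $\rho>0$ there is $M>0$ such that $\|x(t_0)\|\le\rho$ implies $\|x(t)\|\le M$ for all $t\ge t_0$; and for all $\rho,\varepsilon>0$ there is $\tau>0$ such that $\|x(t_0)\|\le\rho$ implies $\|x(t)\|\le\varepsilon$ for all $t\ge t_0+\tau$. -/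

import Mathlib

open scoped NNReal Topology

noncomputable section

namespace EventTriggered

/-! ### Comparison functions -/

/-- Class `K_∞`: continuous, strictly increasing, zero at zero and unbounded. -/
structure IsClassKInf (α : ℝ≥0 → ℝ≥0) : Prop where
  cont : Continuous α
  strictMono : StrictMono α
  map_zero : α 0 = 0
  unbounded : Filter.Tendsto α Filter.atTop Filter.atTop

/-- The set `K_∞ ∪ {0}`. -/
def IsClassKInfOrZero (α : ℝ≥0 → ℝ≥0) : Prop :=
  IsClassKInf α ∨ α = 0

/-- Positive definite functions (no continuity is required). -/
def IsPosDef (α : ℝ≥0 → ℝ≥0) : Prop :=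
  ∀ r, α r = 0 ↔ r = 0

/-- The inverse of a class `K_∞` function (such a function is a bijection of `[0,∞)`). -/
def inv (α : ℝ≥0 → ℝ≥0) : ℝ≥0 → ℝ≥0 :=
  Function.invFun α

/-- A function on `[0,∞)` seen as a function of a real variable; only its restriction to
`(0,∞)` is used. -/
def onReal (α : ℝ≥0 → ℝ≥0) : ℝ → ℝ :=
  fun s => (α s.toNNReal : ℝ)

/-- Monotone aggregation functions on the orthant `[0,∞)^ι`.
The third condition says `μ v → ∞` as `‖v‖ → ∞`. -/
structure IsMAF {ι : Type} [Fintype ι] (μ : (ι → ℝ≥0) → ℝ≥0) : Prop where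
  cont : Continuous μ
  pos : ∀ v, v ≠ 0 → 0 < μ v
  lt_of_lt : ∀ v z : ι → ℝ≥0, (∀ k, z k < v k) → μ z < μ v
  unbounded : Filter.Tendsto μ (Filter.cocompact (ι → ℝ≥0)) Filter.atTop

/-! ### The interconnected system -/

/-- Interconnection of `N` systems `ẋ_i = f_i(x, u_i)`, `u_i = g_i(x + e)`, with
`x_i ∈ ℝ^{n_i}`, `u_i ∈ ℝ^{m_i}`, the `f_i` continuous and the `g_i` locally bounded. -/
structure Interconnection (N : ℕ) where
  n : Fin N → ℕ
  m : Fin N → ℕ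
  f : (i : Fin N) → ((j : Fin N) → EuclideanSpace ℝ (Fin (n j))) →
    EuclideanSpace ℝ (Fin (m i)) → EuclideanSpace ℝ (Fin (n i))
  g : (i : Fin N) → ((j : Fin N) → EuclideanSpace ℝ (Fin (n j))) →
    EuclideanSpace ℝ (Fin (m i))
  f_cont : ∀ i, Continuous
    fun p : ((j : Fin N) → EuclideanSpace ℝ (Fin (n j))) × EuclideanSpace ℝ (Fin (m i)) =>
      f i p.1 p.2
  g_locallyBounded : ∀ i (K : Set ((j : Fin N) → EuclideanSpace ℝ (Fin (n j)))),
    IsCompact K → ∃ C : ℝ, ∀ x ∈ K, ‖g i x‖ ≤ C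

variable {N : ℕ}

/-- The overall state space. -/
abbrev Interconnection.State (S : Interconnection N) : Type :=
  (i : Fin N) → EuclideanSpace ℝ (Fin (S.n i))

/-- The Euclidean norm of the overall state. -/
def Interconnection.euclNorm (S : Interconnection N) (x : S.State) : ℝ :=
  Real.sqrt (∑ i, ‖x i‖ ^ 2)

open Classical in
/-- `Z(j)`: the controllers `g_i` that depend explicitly on `x_j`, that is, those that are not
functions of the other components `x_k`, `k ≠ j`, alone. -/
def Interconnection.Z (S : Interconnection N) (j : Fin N) : Finset (Fin N) :=
  Finset.univ.filter fun i => ¬ DependsOn (S.g i) {k | k ≠ j}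

/-! ### The two assumptions -/

/-- The argument list `(a_1, …, a_N, b_1, …, b_N)` of an aggregation function. -/
abbrev pair (a b : Fin N → ℝ≥0) : Fin N ⊕ Fin N → ℝ≥0 :=
  Sum.elim a b

/-- The subsystems have ISS-Lyapunov functions `V_i` with gains `γ_ij` (states) and
`η_ij` (errors), aggregated by `μ_i`. -/
structure ISSLyapunov (S : Interconnection N)
    (V : (i : Fin N) → EuclideanSpace ℝ (Fin (S.n i)) → ℝ≥0)
    (μ : Fin N → (Fin N ⊕ Fin N → ℝ≥0) → ℝ≥0)
    (γ η : Fin N → Fin N → ℝ≥0 → ℝ≥0) : Prop where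
  differentiable : ∀ i, Differentiable ℝ fun z => (V i z : ℝ)
  bounds : ∀ i, ∃ α₁ α₂ : ℝ≥0 → ℝ≥0, IsClassKInf α₁ ∧ IsClassKInf α₂ ∧
    ∀ z, α₁ ‖z‖₊ ≤ V i z ∧ V i z ≤ α₂ ‖z‖₊
  maf : ∀ i, IsMAF (μ i)
  gain_state : ∀ i j, IsClassKInfOrZero (γ i j)
  gain_diag : ∀ i, γ i i = 0
  gain_error : ∀ i j, IsClassKInfOrZero (η i j)
  /-- The error gain `η_ij` is nonzero iff controller `i` uses the state of system `j`. -/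
  gain_error_iff : ∀ i j, η i j ≠ 0 ↔ i ∈ S.Z j
  decay : ∀ i, ∃ α : ℝ≥0 → ℝ≥0, IsPosDef α ∧ ∀ x e : S.State,
    μ i (pair (fun j => γ i j (V j (x j))) (fun j => η i j ‖e j‖₊)) ≤ V i (x i) →
    fderiv ℝ (fun z => (V i z : ℝ)) (x i) (S.f i x (S.g i (x + e))) ≤ -(α ‖x i‖₊ : ℝ)

/-- The map `Γ_μ(r)`, the error arguments of the `μ_i` being zero. -/
def Gam (μ : Fin N → (Fin N ⊕ Fin N → ℝ≥0) → ℝ≥0) (γ : Fin N → Fin N → ℝ≥0 → ℝ≥0)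
    (r : Fin N → ℝ≥0) : Fin N → ℝ≥0 :=
  fun i => μ i (pair (fun j => γ i j (r j)) 0)

/-- `σ` is an `Ω`-path with respect to `Γ_μ`. -/
structure IsOmegaPath (μ : Fin N → (Fin N ⊕ Fin N → ℝ≥0) → ℝ≥0)
    (γ : Fin N → Fin N → ℝ≥0 → ℝ≥0) (σ : Fin N → ℝ≥0 → ℝ≥0) : Prop where
  kInf : ∀ i, IsClassKInf (σ i)
  locallyLipschitz : ∀ i, LocallyLipschitzOn (Set.Ioi 0) (onReal (inv (σ i)))
  deriv_bounds : ∀ K : Set ℝ, IsCompact K → K ⊆ Set.Ioi 0 →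
    ∃ c C : ℝ, 0 < c ∧ c < C ∧ ∀ i, ∀ r ∈ K, DifferentiableAt ℝ (onReal (inv (σ i))) r →
      c ≤ deriv (onReal (inv (σ i))) r ∧ deriv (onReal (inv (σ i))) r ≤ C
  small_gain : ∀ r : ℝ≥0, 0 < r → ∀ i, Gam μ γ (fun j => σ j r) i < σ i r

/-- The small-gain condition with error gains `φ_ij`.  The gain `φ_ij` has to be invertible
wherever its inverse is used, that is, wherever `η_ij ≠ 0`. -/
structure SmallGain (μ : Fin N → (Fin N ⊕ Fin N → ℝ≥0) → ℝ≥0)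
    (γ η : Fin N → Fin N → ℝ≥0 → ℝ≥0)
    (σ : Fin N → ℝ≥0 → ℝ≥0) (φ : Fin N → Fin N → ℝ≥0 → ℝ≥0) : Prop where
  omegaPath : IsOmegaPath μ γ σ
  error_gain : ∀ i j, IsClassKInfOrZero (φ i j)
  error_gain_ne_zero : ∀ i j, η i j ≠ 0 → φ i j ≠ 0
  small_gain : ∀ r : ℝ≥0, 0 < r → ∀ i,
    μ i (pair (fun j => γ i j (σ j r)) (fun j => φ i j r)) < σ i r

/-! ### The triggering scheme -/

/-- `χ_j = σ_j ∘ max_{i ∈ Z(j)} φ_ij⁻¹ ∘ η_ij`, an empty maximum being zero. -/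
def chi (S : Interconnection N) (η : Fin N → Fin N → ℝ≥0 → ℝ≥0)
    (σ : Fin N → ℝ≥0 → ℝ≥0) (φ : Fin N → Fin N → ℝ≥0 → ℝ≥0)
    (j : Fin N) (r : ℝ≥0) : ℝ≥0 :=
  σ j ((S.Z j).sup fun i => inv (φ i j) (η i j r))

/-- The triggering function `T_i(x_i, e_i) = χ_i(‖e_i‖) - V_i(x_i)`. -/
def trigFun (S : Interconnection N)
    (V : (i : Fin N) → EuclideanSpace ℝ (Fin (S.n i)) → ℝ≥0)
    (η : Fin N → Fin N → ℝ≥0 → ℝ≥0)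
    (σ : Fin N → ℝ≥0 → ℝ≥0) (φ : Fin N → Fin N → ℝ≥0 → ℝ≥0)
    (i : Fin N) (z e : EuclideanSpace ℝ (Fin (S.n i))) : ℝ :=
  (chi S η σ φ i ‖e‖₊ : ℝ) - (V i z : ℝ)

/-- System `i` transmits if `T_i(x_i, e_i) ≥ 0` and `e_i ≠ 0`.  As `T_i(x_i, 0) < 0` for
`x_i ≠ 0`, the second condition only matters at `x_i = 0`, `e_i = 0`: a system transmits when its
state reaches zero, but no more as long as it stays there. -/
def Transmits (S : Interconnection N)
    (T : (i : Fin N) → EuclideanSpace ℝ (Fin (S.n i)) → EuclideanSpace ℝ (Fin (S.n i)) → ℝ)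
    (i : Fin N) (z e : EuclideanSpace ℝ (Fin (S.n i))) : Prop :=
  0 ≤ T i z e ∧ e ≠ 0

/-- `y` solves `ẏ = F(y)` on `[τ, b)`, where `τ < b ≤ ∞`. -/
def IsSolution {E : Type} [NormedAddCommGroup E] [NormedSpace ℝ E]
    (F : E → E) (τ : ℝ) (b : EReal) (y : ℝ → E) : Prop :=
  (τ : EReal) < b ∧
    ∀ s : ℝ, τ ≤ s → (s : EReal) < b → HasDerivWithinAt y (F (y s)) (Set.Ici τ) s

/-- `y` is a solution of `ẏ = F(y)` on `[τ, b)` that has no proper extension to the right. -/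
def IsMaximalSolution {E : Type} [NormedAddCommGroup E] [NormedSpace ℝ E]
    (F : E → E) (τ : ℝ) (b : EReal) (y : ℝ → E) : Prop :=
  IsSolution F τ b y ∧
    ∀ (b' : EReal) (y' : ℝ → E), IsSolution F τ b' y' → b ≤ b' →
      (∀ s : ℝ, τ ≤ s → (s : EReal) < b → y' s = y s) → b' = b

open Classical in
/-- Solutions of the event-triggered system `ẋ_i = f_i(x, g_i(x̂))` with triggering functions
`T_i`, started at time `0` with `e = x̂ - x = 0`.

Here `t k` is the `k`-th event time (`t 0 = 0`, and `t k = ⊤` from some `k` on if there are only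
finitely many events) and `q k` is the constant value of `x̂` after the `k`-th event.  The flow
`y k` with `x̂ = q k`, defined on its maximal interval `[t k, b k)`, is followed until the next event
time, the infimum of the later times at which some system transmits.  At this time precisely these
systems update their component of `x̂`.  The state trajectory `x` is composed of the flows. -/
structure ClosedLoopSolution (S : Interconnection N)
    (T : (i : Fin N) → EuclideanSpace ℝ (Fin (S.n i)) → EuclideanSpace ℝ (Fin (S.n i)) → ℝ) where
  t : ℕ → EReal
  q : ℕ → S.State
  b : ℕ → EReal
  y : ℕ → ℝ → S.State
  x : ℝ → S.State
  t_zero : t 0 = 0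
  q_zero : q 0 = y 0 0
  flow : ∀ (k : ℕ) (τ : ℝ), t k = τ →
    IsMaximalSolution (fun z : S.State => fun i => S.f i z (S.g i (q k))) τ (b k) (y k)
  t_succ : ∀ k : ℕ, t (k + 1) =
    sInf ((fun s : ℝ => (s : EReal)) '' {s : ℝ | t k < s ∧ (s : EReal) < b k ∧
      ∃ i, Transmits S T i (y k s i) (q k i - y k s i)})
  y_succ : ∀ (k : ℕ) (τ : ℝ), t (k + 1) = τ → y (k + 1) τ = y k τ
  q_succ : ∀ (k : ℕ) (τ : ℝ), t (k + 1) = τ → ∀ i, q (k + 1) i =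
    if Transmits S T i (y k τ i) (q k i - y k τ i) then y k τ i else q k i
  x_eq : ∀ (k : ℕ) (s : ℝ), t k ≤ s → (s : EReal) ≤ t (k + 1) → (s : EReal) < b k → x s = y k s

namespace ClosedLoopSolution

variable {S : Interconnection N}
  {T : (i : Fin N) → EuclideanSpace ℝ (Fin (S.n i)) → EuclideanSpace ℝ (Fin (S.n i)) → ℝ}

/-- The set of times at which the solution is defined. -/
def dom (R : ClosedLoopSolution S T) : Set ℝ :=
  {s | ∃ k, R.t k ≤ s ∧ (s : EReal) ≤ R.t (k + 1) ∧ (s : EReal) < R.b k}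

/-- Zeno behavior: the event times converge to a finite time. -/
def IsZeno (R : ClosedLoopSolution S T) : Prop :=
  ∃ τ : ℝ, Filter.Tendsto R.t Filter.atTop (𝓝 (τ : EReal))

end ClosedLoopSolution

/-- The origin is a globally uniformly asymptotically stable equilibrium for the set `𝒮` of
closed-loop solutions: the solutions exist for all `t ≥ 0`, those that start at the origin stay
there, and the origin is uniformly stable, the solutions are uniformly bounded, and the origin is
uniformly globally attractive.  Uniformity is with respect to the initial time `t₀`,
the state at time `t₀`, and the solution. -/
structure IsGUAS {S : Interconnection N}
    {T : (i : Fin N) → EuclideanSpace ℝ (Fin (S.n i)) → EuclideanSpace ℝ (Fin (S.n i)) → ℝ}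
    (𝒮 : Set (ClosedLoopSolution S T)) : Prop where
  complete : ∀ R ∈ 𝒮, R.dom = Set.Ici 0
  equilibrium : ∀ R ∈ 𝒮, R.x 0 = 0 → ∀ t : ℝ, 0 ≤ t → R.x t = 0
  stable : ∀ ε : ℝ, 0 < ε → ∃ δ : ℝ, 0 < δ ∧ ∀ R ∈ 𝒮, ∀ t₀ t : ℝ, 0 ≤ t₀ → t₀ ≤ t →
    S.euclNorm (R.x t₀) ≤ δ → S.euclNorm (R.x t) ≤ ε
  bounded : ∀ ρ : ℝ, 0 < ρ → ∃ M : ℝ, 0 < M ∧ ∀ R ∈ 𝒮, ∀ t₀ t : ℝ, 0 ≤ t₀ → t₀ ≤ t →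
    S.euclNorm (R.x t₀) ≤ ρ → S.euclNorm (R.x t) ≤ M
  attractive : ∀ ρ ε : ℝ, 0 < ρ → 0 < ε → ∃ τ : ℝ, 0 < τ ∧ ∀ R ∈ 𝒮, ∀ t₀ t : ℝ, 0 ≤ t₀ →
    t₀ + τ ≤ t → S.euclNorm (R.x t₀) ≤ ρ → S.euclNorm (R.x t) ≤ ε

end EventTriggered

end

/-! The Lyapunov function is W(x) = max_i σ_i⁻¹(V_i(x_i)), called `lyap`. While system j does not
transmit, χ_j(‖e_j‖) ≤ V_j(x_j); the form of χ_j turns this into η_ij(‖e_j‖) ≤ φ_ij(W(x)) for every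
controller i using x_j. The small-gain condition at r = W(x) > 0 then places each i attaining the
maximum in the decay regime of V_i, so exactly the components that determine W decrease strictly.

Hence W never grows (`IsTrajectory.lyap_le`), which gives stability and boundedness. Its sublevel
sets are compact, so velocities are bounded (`exists_bound_field`) and a flow cannot end before the
next event (`lt_b`, resting on Peano's theorem); without Zeno behavior the event times exhaust
[0,∞).

Uniform attraction needs more, since α_i, g_i and ∇V_i may be discontinuous. With the gradient
frozen at a point z, `eventually_decay` gives one negative bound for all states near z and all
admissible transmitted values. Over a short time this yields a fixed loss of W
(`eventually_lyap_add_le`), compactness of {c ≤ W ≤ C} makes the loss uniform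
(`exists_uniform_decrease`), and finitely many such losses lead to W ≤ c. In `IsTrajectory` the
transmitted value may change at every instant, so event times play no role in these estimates. -/

noncomputable section

namespace EventTriggered

/-! ### Solutions of autonomous differential equations -/

section Peano

open MeasureTheory

/-- Equi-Lipschitz curves on a compact interval with values in a compact set have a uniformly
convergent subsequence. -/
theorem exists_subseq_tendsto_of_lipschitzWith {E X : Type*} [NormedAddCommGroup E]
    [MetricSpace X] [CompactSpace X]
    {K : Set E} (hK : IsCompact K) {L : ℝ≥0} (z : ℕ → X → E)
    (hz : ∀ n, LipschitzWith L (z n)) (hzK : ∀ n x, z n x ∈ K) :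
    ∃ g : X → E, Continuous g ∧ ∃ k : ℕ → ℕ, StrictMono k ∧
      ∀ x, Filter.Tendsto (fun n => z (k n) x) Filter.atTop (𝓝 (g x)) := by
  let w : ℕ → BoundedContinuousFunction X E := fun n =>
    BoundedContinuousFunction.mkOfCompact ⟨z n, (hz n).continuous⟩
  let A : Set (BoundedContinuousFunction X E) := Set.range w
  have hA : IsCompact (closure A) := by
    refine BoundedContinuousFunction.arzela_ascoli K hK A ?_ ?_
    · rintro f x ⟨n, rfl⟩
      exact hzK n x
    · refine Metric.equicontinuous_of_continuity_modulus (fun r => L * r) ?_ _ ?_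
      · have : Continuous fun r : ℝ => (L : ℝ) * r := by fun_prop
        simpa using this.tendsto 0
      · rintro x y ⟨_, n, rfl⟩
        exact (hz n).dist_le_mul x y
  obtain ⟨g, -, k, hk, hg⟩ := hA.tendsto_subseq fun n => subset_closure (Set.mem_range_self n)
  refine ⟨g, g.continuous, k, hk, fun x => ?_⟩
  exact (BoundedContinuousFunction.tendsto_iff_tendstoUniformly.1 hg).tendsto_at x

variable {E : Type*} [NormedAddCommGroup E] [NormedSpace ℝ E] [FiniteDimensional ℝ E]

/-- **Peano existence theorem** for autonomous equations. -/
theorem exists_hasDerivWithinAt_of_continuous {F : E → E} (hF : Continuous F) (x₀ : E) (b : ℝ) :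
    ∃ δ > 0, ∃ z : ℝ → E, z b = x₀ ∧
      ∀ s ∈ Set.Icc b (b + δ), HasDerivWithinAt z (F (z s)) (Set.Icc b (b + δ)) s := by
  have hball : IsCompact (Metric.closedBall x₀ 1) := isCompact_closedBall x₀ 1
  obtain ⟨M, hM⟩ := hball.exists_bound_of_continuousOn hF.continuousOn
  have hM0 : 0 ≤ M := (norm_nonneg _).trans (hM x₀ (by simp))
  -- The extra 1 absorbs the approximation error below; with δ = 1 / L, curves of speed at most L
  -- stay in the unit ball.
  let L : ℝ≥0 := ⟨M + 1, by linarith⟩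
  have hL : (L : ℝ) = M + 1 := rfl
  have hL0 : (0 : ℝ) < L := by rw [hL]; linarith
  let δ : ℝ := 1 / L
  have hδ : 0 < δ := by positivity
  let t₀ : Set.Icc b (b + δ) := ⟨b, by simp [hδ.le]⟩
  -- C¹ approximants are Lipschitz on the ball, so Picard–Lindelöf applies to each; their solutions
  -- share the Lipschitz constant L, and Arzelà–Ascoli extracts a limit.
  have happ : ∀ n : ℕ, ∃ G : E → E, ContDiff ℝ 1 G ∧ ∀ x, dist (G x) (F x) < 1 / ((n : ℝ) + 1) := by
    intro n
    obtain ⟨G, h₁, h₂, -⟩ := hF.exists_contDiff_approx (ε := fun _ => 1 / ((n : ℝ) + 1)) 1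
      continuous_const (fun _ => by positivity)
    exact ⟨G, h₁, h₂⟩
  choose G hG hGF using happ
  have hGL : ∀ n, ∀ x ∈ Metric.closedBall x₀ ((1 : ℝ≥0) : ℝ), ‖G n x‖ ≤ L := by
    intro n x hx
    have h₁ : dist (G n x) (F x) < 1 := (hGF n x).trans_le (by
      rw [div_le_one (by positivity)]
      linarith [(Nat.cast_nonneg n : (0 : ℝ) ≤ n)])
    rw [dist_eq_norm] at h₁
    have h₂ := norm_le_norm_sub_add (G n x) (F x)
    have h₃ := hM x (by simpa using hx)
    rw [hL]
    linarith
  have hm : (L : ℝ) * max (b + δ - t₀) (t₀ - b) ≤ ((1 : ℝ≥0) : ℝ) - ((0 : ℝ≥0) : ℝ) := by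
    have : max (b + δ - (t₀ : ℝ)) (t₀ - b) = δ := by
      change max (b + δ - b) (b - b) = δ
      simp [hδ.le]
    rw [this]
    simp only [δ, NNReal.coe_one, NNReal.coe_zero, sub_zero]
    rw [mul_one_div_cancel hL0.ne']
  have hsol : ∀ n, ∃ α : ODE.FunSpace t₀ x₀ 0 L, ∀ t : Set.Icc b (b + δ),
      α t = ODE.picard (fun _ => G n) t₀ x₀ α.compProj t := by
    intro n
    obtain ⟨K, hK⟩ := (hG n).contDiffOn.exists_lipschitzOnWith one_ne_zero
      (convex_closedBall x₀ 1) hball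
    have hpl : IsPicardLindelof (fun _ => G n) t₀ x₀ 1 0 L K :=
      .of_time_independent (hGL n) (by simpa using hK) hm
    obtain ⟨α, hα⟩ := ODE.FunSpace.exists_isFixedPt_next hpl (x := x₀) (by simp)
    exact ⟨α, (ODE.FunSpace.isFixedPt_next_iff hpl (by simp)).1 hα⟩
  choose α hα using hsol
  have hmem : ∀ n t, α n t ∈ Metric.closedBall x₀ 1 := fun n t => by
    simpa using (α n).mem_closedBall hm (t := t)
  obtain ⟨g, hg, k, hk, hlim⟩ := exists_subseq_tendsto_of_lipschitzWith hball
    (fun n => (α n).toFun) (fun n => (α n).lipschitzWith) hmem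
  let p : ℝ → Set.Icc b (b + δ) := Set.projIcc b (b + δ) (by linarith)
  have hp : Continuous p := continuous_projIcc
  let z : ℝ → E := fun s => g (p s)
  have hz : Continuous z := hg.comp hp
  -- The integral equations pass to the limit by dominated convergence.
  have hint : ∀ t : Set.Icc b (b + δ), g t = ODE.picard (fun _ => F) t₀ x₀ z t := by
    intro t
    refine tendsto_nhds_unique (hlim t) ?_
    have hGk : ∀ n, Continuous fun s => G (k n) ((α (k n)).compProj s) := fun n =>
      (hG _).continuous.comp (α _).continuous_compProj
    have : Filter.Tendsto (fun n => ∫ s in (t₀ : ℝ)..t, G (k n) ((α (k n)).compProj s))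
        Filter.atTop (𝓝 (∫ s in (t₀ : ℝ)..t, F (z s))) := by
      refine intervalIntegral.tendsto_integral_filter_of_dominated_convergence (fun _ => (L : ℝ))
        (.of_forall fun n => (hGk n).aestronglyMeasurable)
        (.of_forall fun n => .of_forall fun s _ => hGL _ _ (by simpa using hmem (k n) (p s)))
        intervalIntegrable_const (.of_forall fun s _ => ?_)
      have h₁ : Filter.Tendsto (fun n => F (α (k n) (p s))) Filter.atTop (𝓝 (F (z s))) :=
        (hF.tendsto _).comp (hlim (p s))
      refine h₁.congr_dist ?_
      refine squeeze_zero (fun _ => dist_nonneg) (fun n => ?_)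
        ((tendsto_one_div_add_atTop_nhds_zero_nat (𝕜 := ℝ)).comp hk.tendsto_atTop)
      rw [dist_comm]
      exact (hGF (k n) _).le
    refine (this.const_add x₀).congr fun n => ?_
    exact (hα (k n) t).symm
  refine ⟨δ, hδ, z, ?_, fun s hs => ?_⟩
  · have : p b = t₀ := Set.projIcc_left _
    change g (p b) = x₀
    rw [this, hint]
    simp
  · have h := ODE.hasDerivWithinAt_picard_Icc (f := fun _ => F) (α := z) (u := Set.univ)
      (t₀ := (t₀ : ℝ)) t₀.2 (by
        change ContinuousOn (fun q : ℝ × E => F q.2) _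
        fun_prop) hz.continuousOn (fun _ _ => Set.mem_univ _) x₀ hs
    refine h.congr (fun r hr => ?_) ?_
    · change g (p r) = _
      rw [show p r = ⟨r, hr⟩ from Set.projIcc_of_mem _ hr, hint ⟨r, hr⟩]
    · change g (p s) = _
      rw [show p s = ⟨s, hs⟩ from Set.projIcc_of_mem _ hs, hint ⟨s, hs⟩]

end Peano

/-- A solution along which the vector field is bounded can be continued, so that a maximal one is
defined for all later times. -/
theorem IsMaximalSolution.eq_top_of_bounded {E : Type} [NormedAddCommGroup E] [NormedSpace ℝ E]
    [FiniteDimensional ℝ E] {F : E → E} (hF : Continuous F) {τ : ℝ} {b : EReal} {y : ℝ → E}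
    (hy : IsMaximalSolution F τ b y) {L : ℝ≥0}
    (hL : ∀ s : ℝ, τ ≤ s → (s : EReal) < b → ‖F (y s)‖₊ ≤ L) : b = ⊤ := by
  obtain ⟨⟨hτb, hsol⟩, hmax⟩ := hy
  induction b with
  | bot => simp at hτb
  | top => rfl
  | coe B =>
    exfalso
    simp only [EReal.coe_lt_coe_iff] at hτb hsol hL
    -- Bounded speed makes y Lipschitz up to the finite end B. Its Lipschitz extension w supplies
    -- the limit value there, and the limit of the derivatives supplies the left derivative; a Peano
    -- solution started at w B then prolongs y, against maximality.
    have hlip : LipschitzOnWith L y (Set.Ico τ B) :=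
      (convex_Ico τ B).lipschitzOnWith_of_nnnorm_hasDerivWithin_le
        (fun s hs => (hsol s hs.1 hs.2).mono Set.Ico_subset_Ici_self) (fun s hs => hL s hs.1 hs.2)
    obtain ⟨w, hwlip, hw⟩ := hlip.extend_finite_dimension
    have hwc : Continuous w := hwlip.continuous
    have hder : ∀ s ∈ Set.Ioo τ B, HasDerivAt w (F (w s)) s := by
      intro s hs
      have h₁ : HasDerivAt y (F (y s)) s := (hsol s hs.1.le hs.2).hasDerivAt (Ici_mem_nhds hs.1)
      rw [hw ⟨hs.1.le, hs.2⟩] at h₁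
      refine h₁.congr_of_eventuallyEq ?_
      filter_upwards [Ioo_mem_nhds hs.1 hs.2] with r hr
      exact (hw ⟨hr.1.le, hr.2⟩).symm
    have hleft : HasDerivWithinAt w (F (w B)) (Set.Iic B) B := by
      refine hasDerivWithinAt_Iic_of_tendsto_deriv (s := Set.Ioo τ B)
        (fun s hs => (hder s hs).differentiableAt.differentiableWithinAt)
        hwc.continuousWithinAt (Ioo_mem_nhdsLT hτb) ?_
      refine (((hF.comp hwc).tendsto B).mono_left nhdsWithin_le_nhds).congr' ?_
      filter_upwards [Ioo_mem_nhdsLT hτb] with s hs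
      exact (hder s hs).deriv.symm
    obtain ⟨δ, hδ, z, hz₀, hz⟩ := exists_hasDerivWithinAt_of_continuous hF (w B) B
    let v : ℝ → E := fun s => if s ≤ B then w s else z s
    have hvw : ∀ s ≤ B, v s = w s := fun s hs => if_pos hs
    have hvz : ∀ s, B ≤ s → v s = z s := by
      intro s hs
      rcases hs.eq_or_lt with rfl | hs
      · rw [hvw _ le_rfl, hz₀]
      · exact if_neg hs.not_ge
    have hv : IsSolution F τ ((B + δ : ℝ) : EReal) v := by
      refine ⟨EReal.coe_lt_coe_iff.2 (by linarith), fun s hs hs' => ?_⟩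
      rw [EReal.coe_lt_coe_iff] at hs'
      rcases lt_trichotomy s B with h | rfl | h
      · have h₁ := hsol s hs h
        rw [show F (v s) = F (y s) by rw [hvw s h.le, hw ⟨hs, h⟩]]
        refine h₁.congr_of_eventuallyEq ?_ (by rw [hvw s h.le, hw ⟨hs, h⟩])
        filter_upwards [self_mem_nhdsWithin, mem_nhdsWithin_of_mem_nhds (Iio_mem_nhds h)]
          with r hr hr'
        rw [hvw r (le_of_lt hr'), hw ⟨hr, hr'⟩]
      · have h₁ : HasDerivWithinAt v (F (v s)) (Set.Iic s) s := by
          rw [hvw s le_rfl]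
          exact hleft.congr (fun r hr => hvw r hr) (hvw s le_rfl)
        have h₂ : HasDerivWithinAt v (F (v s)) (Set.Ici s) s := by
          rw [hvz s le_rfl]
          exact ((hz s ⟨le_rfl, by linarith⟩).mono_of_mem_nhdsWithin
            (Icc_mem_nhdsGE (by linarith))).congr (fun r hr => hvz r hr) (hvz s le_rfl)
        have h₃ := h₁.union h₂
        rw [Set.Iic_union_Ici] at h₃
        exact h₃.mono (Set.subset_univ _)
      · have h₁ := (hz s ⟨h.le, hs'.le⟩).hasDerivAt (Icc_mem_nhds h hs')
        rw [hvz s h.le]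
        refine (h₁.congr_of_eventuallyEq ?_).hasDerivWithinAt
        filter_upwards [Ioi_mem_nhds h] with r hr
        exact hvz r (le_of_lt hr)
    have := hmax _ v hv (EReal.coe_le_coe_iff.2 (by linarith)) (by
      intro s hs hs'
      rw [EReal.coe_lt_coe_iff] at hs'
      rw [hvw s hs'.le, hw ⟨hs, hs'⟩])
    rw [EReal.coe_eq_coe_iff] at this
    linarith

/-! ### Comparison functions -/

namespace IsClassKInf

variable {α : ℝ≥0 → ℝ≥0} (h : IsClassKInf α)
include h

theorem surjective : Function.Surjective α := fun r =>
  mem_range_of_exists_le_of_exists_ge h.cont ⟨0, by simp [h.map_zero]⟩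
    ((h.unbounded.eventually_ge_atTop r).exists)

theorem apply_inv (r : ℝ≥0) : α (inv α r) = r :=
  Function.rightInverse_invFun h.surjective r

theorem inv_apply (r : ℝ≥0) : inv α (α r) = r :=
  Function.leftInverse_invFun h.strictMono.injective r

theorem inv_le_iff {r s : ℝ≥0} : inv α r ≤ s ↔ r ≤ α s := by
  rw [← h.strictMono.le_iff_le, h.apply_inv]

theorem le_inv_iff {r s : ℝ≥0} : s ≤ inv α r ↔ α s ≤ r := by
  rw [← h.strictMono.le_iff_le, h.apply_inv]

theorem inv_lt_iff {r s : ℝ≥0} : inv α r < s ↔ r < α s := by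
  rw [← h.strictMono.lt_iff_lt, h.apply_inv]

theorem inv_zero : inv α 0 = 0 := by
  rw [← h.map_zero, h.inv_apply, h.map_zero]

theorem inv_strictMono : StrictMono (inv α) := fun r s hrs => by
  rwa [h.inv_lt_iff, h.apply_inv]

theorem inv_continuous : Continuous (inv α) :=
  h.inv_strictMono.monotone.continuous_of_surjective fun r => ⟨α r, h.inv_apply r⟩

theorem pos {r : ℝ≥0} (hr : 0 < r) : 0 < α r := by
  simpa [h.map_zero] using h.strictMono hr

end IsClassKInf

namespace IsClassKInfOrZero

variable {α : ℝ≥0 → ℝ≥0} (h : IsClassKInfOrZero α)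
include h

theorem map_zero : α 0 = 0 := by
  rcases h with h | rfl
  exacts [h.map_zero, rfl]

theorem monotone : Monotone α := by
  rcases h with h | rfl
  exacts [h.strictMono.monotone, monotone_const]

theorem continuous : Continuous α := by
  rcases h with h | rfl
  exacts [h.cont, continuous_const]

theorem isClassKInf (h₀ : α ≠ 0) : IsClassKInf α := h.resolve_right h₀

end IsClassKInfOrZero

/-- Strict growth is available only when all arguments grow, so the larger vector is shifted by ε >
0 and continuity is used as ε → 0. -/
theorem IsMAF.monotone {ι : Type} [Fintype ι] {μ : (ι → ℝ≥0) → ℝ≥0} (h : IsMAF μ) :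
    Monotone μ := by
  intro v z hvz
  have hc : Continuous fun ε : ℝ≥0 => μ fun k => z k + ε :=
    h.cont.comp (by fun_prop)
  have ht : Filter.Tendsto (fun ε : ℝ≥0 => μ fun k => z k + ε) (𝓝[>] 0) (𝓝 (μ z)) := by
    simpa using (hc.tendsto 0).mono_left nhdsWithin_le_nhds
  refine ge_of_tendsto ht ?_
  filter_upwards [self_mem_nhdsWithin] with ε hε
  exact (h.lt_of_lt _ _ fun k => (hvz k).trans_lt (lt_add_of_pos_right _ hε)).le

variable {N : ℕ}

/-! ### The controllers -/

/-- Membership in `Z` concerns one component at a time. As there are finitely many, x is turned into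
y component by component, each change leaving the value of the controller fixed. -/
theorem Interconnection.dependsOn_g (S : Interconnection N) (i : Fin N) :
    DependsOn (S.g i) {j | i ∈ S.Z j} := by
  classical
  intro x y hxy
  have key : ∀ s : Finset (Fin N), S.g i (s.piecewise y x) = S.g i x := by
    intro s
    induction s using Finset.induction_on with
    | empty => simp
    | insert a s ha ih =>
      rw [← ih]
      by_cases hi : i ∈ S.Z a
      · congr 1
        rw [Finset.piecewise_insert, ← hxy a hi, Function.update_eq_self_iff]
        simp [ha]
      · have hd : DependsOn (S.g i) {k | k ≠ a} := by
          simpa [Interconnection.Z] using hi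
        refine hd fun k hk => ?_
        rw [Finset.piecewise_insert, Function.update_of_ne hk]
  simpa using (key Finset.univ).symm

/-- Outside the components a controller depends on, its argument may be replaced. -/
def Interconnection.restrictTo (S : Interconnection N) (i : Fin N) (q x : S.State) : S.State :=
  fun j => if i ∈ S.Z j then q j else x j

theorem Interconnection.g_restrictTo (S : Interconnection N) (i : Fin N) (q x : S.State) :
    S.g i (S.restrictTo i q x) = S.g i q :=
  S.dependsOn_g i fun _ hj => if_pos hj

/-- The vector field of the closed loop, `q` being the transmitted state. -/
def Interconnection.field (S : Interconnection N) (x q : S.State) : S.State :=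
  fun i => S.f i x (S.g i q)

theorem Interconnection.continuous_field (S : Interconnection N) (q : S.State) :
    Continuous fun x => S.field x q :=
  continuous_pi fun i => (S.f_cont i).comp (by fun_prop : Continuous fun x => (x, S.g i q))

/-! ### The Lyapunov function -/

section Lyapunov

variable {S : Interconnection N} {V : (i : Fin N) → EuclideanSpace ℝ (Fin (S.n i)) → ℝ≥0}
  {μ : Fin N → (Fin N ⊕ Fin N → ℝ≥0) → ℝ≥0} {γ η : Fin N → Fin N → ℝ≥0 → ℝ≥0}
  {σ : Fin N → ℝ≥0 → ℝ≥0} {φ : Fin N → Fin N → ℝ≥0 → ℝ≥0}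

theorem ISSLyapunov.continuous (h : ISSLyapunov S V μ γ η) (i : Fin N) : Continuous (V i) :=
  continuous_induced_rng.2 (h.differentiable i).continuous

theorem ISSLyapunov.map_zero (h : ISSLyapunov S V μ γ η) (i : Fin N) : V i 0 = 0 := by
  obtain ⟨α₁, α₂, -, h₂, hV⟩ := h.bounds i
  simpa [h₂.map_zero] using (hV 0).2

/-- The maximum of the `σ_i⁻¹ ∘ V_i`. -/
def lyap (V : (i : Fin N) → EuclideanSpace ℝ (Fin (S.n i)) → ℝ≥0) (σ : Fin N → ℝ≥0 → ℝ≥0)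
    (x : S.State) : ℝ≥0 :=
  Finset.univ.sup fun i => inv (σ i) (V i (x i))

theorem lyap_le_iff (hσ : ∀ i, IsClassKInf (σ i)) {x : S.State} {r : ℝ≥0} :
    lyap V σ x ≤ r ↔ ∀ i, V i (x i) ≤ σ i r := by
  simp [lyap, (hσ _).inv_le_iff]

theorem continuous_lyap (h : ISSLyapunov S V μ γ η) (hσ : ∀ i, IsClassKInf (σ i)) :
    Continuous (lyap V σ) :=
  Continuous.finset_sup_apply fun i _ =>
    (hσ i).inv_continuous.comp ((h.continuous i).comp (continuous_apply i))

/-- The closed ball containing a sublevel set of the Lyapunov function. -/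
theorem exists_norm_le_of_lyap_le (h : ISSLyapunov S V μ γ η) (hσ : ∀ i, IsClassKInf (σ i)) :
    ∃ β : ℝ≥0 → ℝ, Continuous β ∧ β 0 = 0 ∧
      ∀ (x : S.State) (r : ℝ≥0), lyap V σ x ≤ r → S.euclNorm x ≤ β r ∧ ‖x‖ ≤ β r := by
  choose α₁ α₂ h₁ h₂ hV using h.bounds
  refine ⟨fun r => ∑ i, (inv (α₁ i) (σ i r) : ℝ), ?_, ?_, fun x r hx => ?_⟩
  · exact continuous_finsetSum _ fun i _ =>
      NNReal.continuous_coe.comp ((h₁ i).inv_continuous.comp (hσ i).cont)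
  · simp [(hσ _).map_zero, (h₁ _).inv_zero]
  · rw [lyap_le_iff hσ] at hx
    have hi : ∀ i, ‖x i‖ ≤ inv (α₁ i) (σ i r) := fun i => by
      have : ‖x i‖₊ ≤ inv (α₁ i) (σ i r) := (h₁ i).le_inv_iff.2 ((hV i _).1.trans (hx i))
      exact_mod_cast this
    have hsum : ∑ i, ‖x i‖ ≤ ∑ i, (inv (α₁ i) (σ i r) : ℝ) := Finset.sum_le_sum fun i _ => hi i
    constructor
    · refine le_trans ?_ hsum
      refine Real.sqrt_le_iff.2 ⟨Finset.sum_nonneg fun i _ => norm_nonneg _, ?_⟩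
      exact Finset.sum_sq_le_sq_sum_of_nonneg fun i _ => norm_nonneg _
    · refine le_trans ?_ hsum
      refine (pi_norm_le_iff_of_nonneg (Finset.sum_nonneg fun i _ => norm_nonneg _)).2 fun i => ?_
      exact Finset.single_le_sum (f := fun i => ‖x i‖) (fun i _ => norm_nonneg _)
        (Finset.mem_univ i)

theorem exists_lyap_le_of_norm_le (h : ISSLyapunov S V μ γ η) (hσ : ∀ i, IsClassKInf (σ i)) :
    ∃ β : ℝ≥0 → ℝ≥0, Continuous β ∧ β 0 = 0 ∧
      ∀ (x : S.State) (r : ℝ≥0), S.euclNorm x ≤ r → lyap V σ x ≤ β r := by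
  choose α₁ α₂ h₁ h₂ hV using h.bounds
  refine ⟨fun r => Finset.univ.sup fun i => inv (σ i) (α₂ i r), ?_, ?_, fun x r hx => ?_⟩
  · exact Continuous.finset_sup_apply fun i _ => (hσ i).inv_continuous.comp (h₂ i).cont
  · rw [← bot_eq_zero, Finset.sup_eq_bot_iff]
    simp [(h₂ _).map_zero, (hσ _).inv_zero]
  · refine Finset.sup_mono_fun fun i _ => (hσ i).inv_strictMono.monotone ?_
    refine (hV i _).2.trans ((h₂ i).strictMono.monotone ?_)
    have : ‖x i‖ ≤ r := by
      refine le_trans (Real.le_sqrt_of_sq_le ?_) hx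
      exact Finset.single_le_sum (f := fun i => ‖x i‖ ^ 2) (fun i _ => by positivity)
        (Finset.mem_univ i)
    exact_mod_cast this

/-- The transmitted state `q` does not violate the triggering condition at the state `x`. -/
def Admissible (S : Interconnection N) (V : (i : Fin N) → EuclideanSpace ℝ (Fin (S.n i)) → ℝ≥0)
    (η : Fin N → Fin N → ℝ≥0 → ℝ≥0) (σ : Fin N → ℝ≥0 → ℝ≥0) (φ : Fin N → Fin N → ℝ≥0 → ℝ≥0)
    (x q : S.State) : Prop :=
  ∀ j, chi S η σ φ j ‖q j - x j‖₊ ≤ V j (x j)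

theorem isClassKInf_error (h : ISSLyapunov S V μ γ η) (hS : SmallGain μ γ η σ φ) {i j : Fin N}
    (hij : i ∈ S.Z j) : IsClassKInf (η i j) ∧ IsClassKInf (φ i j) := by
  have hη := (h.gain_error_iff i j).2 hij
  exact ⟨(h.gain_error i j).isClassKInf hη,
    (hS.error_gain i j).isClassKInf (hS.error_gain_ne_zero i j hη)⟩

/-- This is what χ_j is designed for: σ_j cancels in χ_j(‖e_j‖) ≤ V_j(x_j) ≤ σ_j(r), and inverting
φ_ij gives the claim. -/
theorem Admissible.error_le (h : ISSLyapunov S V μ γ η) (hS : SmallGain μ γ η σ φ)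
    {x q : S.State} (hq : Admissible S V η σ φ x q) {r : ℝ≥0} (hr : lyap V σ x ≤ r) {i j : Fin N}
    (hij : i ∈ S.Z j) : η i j ‖q j - x j‖₊ ≤ φ i j r := by
  obtain ⟨-, hφ⟩ := isClassKInf_error h hS hij
  have hσ := hS.omegaPath.kInf
  have h₁ := (hq j).trans ((lyap_le_iff hσ).1 hr j)
  rw [chi, (hσ j).strictMono.le_iff_le, Finset.sup_le_iff] at h₁
  exact hφ.inv_le_iff.1 (h₁ i hij)

theorem exists_bound_input (h : ISSLyapunov S V μ γ η) (hS : SmallGain μ γ η σ φ) (C : ℝ≥0) :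
    ∃ B : ℝ, ∀ x q : S.State, lyap V σ x ≤ C → Admissible S V η σ φ x q → ∀ i, ‖S.g i q‖ ≤ B := by
  obtain ⟨β, -, -, hβ⟩ := exists_norm_le_of_lyap_le h hS.omegaPath.kInf
  have key : ∀ i, ∃ B : ℝ, ∀ x q : S.State, lyap V σ x ≤ C → Admissible S V η σ φ x q →
      ‖S.g i q‖ ≤ B := by
    intro i
    let R : ℝ := β C + ∑ j, (inv (η i j) (φ i j C) : ℝ)
    obtain ⟨B, hB⟩ := S.g_locallyBounded i _ (isCompact_closedBall 0 R)
    refine ⟨B, fun x q hx hq => ?_⟩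
    -- Admissibility does not bound the components of q that g_i ignores; they are replaced by those
    -- of x, so that the argument lies in a fixed ball.
    rw [← S.g_restrictTo i q x]
    refine hB _ (mem_closedBall_zero_iff.2 ?_)
    have hx' := (hβ x C hx).2
    have hsum : ∀ j, (inv (η i j) (φ i j C) : ℝ) ≤ ∑ j, (inv (η i j) (φ i j C) : ℝ) := fun j =>
      Finset.single_le_sum (f := fun j => (inv (η i j) (φ i j C) : ℝ)) (fun j _ => NNReal.coe_nonneg _)
        (Finset.mem_univ j)
    have hR : 0 ≤ R := add_nonneg ((norm_nonneg _).trans hx')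
      (Finset.sum_nonneg fun j _ => NNReal.coe_nonneg _)
    refine (pi_norm_le_iff_of_nonneg hR).2 fun j => ?_
    have hxj : ‖x j‖ ≤ β C := (norm_le_pi_norm x j).trans hx'
    unfold Interconnection.restrictTo
    split_ifs with hij
    · have h₁ := (isClassKInf_error h hS hij).1.le_inv_iff.2 (hq.error_le h hS hx hij)
      have h₂ : ‖q j - x j‖ ≤ inv (η i j) (φ i j C) := by exact_mod_cast h₁
      have h₃ := norm_le_norm_sub_add (q j) (x j)
      have h₄ := hsum j
      change ‖q j‖ ≤ β C + _
      linarith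
    · refine hxj.trans (le_add_of_nonneg_right (Finset.sum_nonneg fun j _ => NNReal.coe_nonneg _))
  choose B hB using key
  refine ⟨∑ i, |B i|, fun x q hx hq i => ((hB i x q hx hq).trans (le_abs_self _)).trans ?_⟩
  exact Finset.single_le_sum (f := fun i => |B i|) (fun i _ => abs_nonneg _) (Finset.mem_univ i)

/-- The bound is uniform in the transmitted state; it controls the speed of trajectories and allows
continuation of flows. -/
theorem exists_bound_field (h : ISSLyapunov S V μ γ η) (hS : SmallGain μ γ η σ φ) (C : ℝ≥0) :
    ∃ L : ℝ≥0, ∀ x q : S.State, lyap V σ x ≤ C → Admissible S V η σ φ x q →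
      ‖S.field x q‖₊ ≤ L := by
  obtain ⟨β, -, -, hβ⟩ := exists_norm_le_of_lyap_le h hS.omegaPath.kInf
  obtain ⟨B, hB⟩ := exists_bound_input h hS C
  have key : ∀ i, ∃ L : ℝ, ∀ x u, ‖x‖ ≤ β C → ‖u‖ ≤ B → ‖S.f i x u‖ ≤ L := by
    intro i
    obtain ⟨L, hL⟩ := ((isCompact_closedBall (0 : S.State) (β C)).prod
      (isCompact_closedBall (0 : EuclideanSpace ℝ (Fin (S.m i))) B)).exists_bound_of_continuousOn
      (S.f_cont i).continuousOn
    exact ⟨L, fun x u hx hu => hL (x, u) ⟨by simpa using hx, by simpa using hu⟩⟩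
  choose L hL using key
  refine ⟨∑ i, (L i).toNNReal, fun x q hx hq => pi_nnnorm_le_iff.2 fun i => ?_⟩
  refine (NNReal.le_toNNReal_of_coe_le (hL i x _ (hβ x C hx).2 (hB x q hx hq i))).trans ?_
  exact Finset.single_le_sum (f := fun i => (L i).toNNReal) (fun i _ => zero_le)
    (Finset.mem_univ i)

/-- Strict decay at a point of those `V_i` that attain the maximum, for the vector fields at all
nearby states. -/
theorem eventually_decay (h : ISSLyapunov S V μ γ η) (hS : SmallGain μ γ η σ φ) {z : S.State}
    (hz : 0 < lyap V σ z) {i : Fin N} (hi : V i (z i) = σ i (lyap V σ z)) :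
    ∃ a : ℝ, 0 < a ∧ ∀ᶠ x in 𝓝 z, ∀ q, Admissible S V η σ φ x q →
      fderiv ℝ (fun y => (V i y : ℝ)) (z i) (S.field x q i) ≤ -a := by
  set r := lyap V σ z with hr
  set ℓ := fderiv ℝ (fun y => (V i y : ℝ)) (z i) with hℓ
  have hσ := hS.omegaPath.kInf
  have hW := continuous_lyap h hσ
  obtain ⟨α, hα, hdec⟩ := h.decay i
  have hzi : z i ≠ 0 := by
    intro h₀
    rw [h₀, h.map_zero] at hi
    exact ((hσ i).pos hz).ne hi
  have hαz : 0 < α ‖z i‖₊ := pos_iff_ne_zero.2 fun h₀ => hzi (by simpa using (hα _).1 h₀)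
  -- The strict small-gain inequality leaves room ε in the error arguments. It pays for q being
  -- admissible at x while the decay estimate is applied at z: half for the change of W, half for
  -- ‖x_j - z_j‖.
  obtain ⟨ε, hε, hμε⟩ : ∃ ε : ℝ≥0, 0 < ε ∧
      μ i (pair (fun j => γ i j (σ j r)) (fun j => φ i j r + ε)) < σ i r := by
    have hc : Continuous fun ε : ℝ≥0 =>
        μ i (pair (fun j => γ i j (σ j r)) (fun j => φ i j r + ε)) := by
      refine (h.maf i).cont.comp (continuous_pi fun k => ?_)
      rcases k with k | k
      · exact continuous_const
      · exact continuous_const.add continuous_id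
    have h₀ : ∀ᶠ ε in 𝓝[>] (0 : ℝ≥0),
        μ i (pair (fun j => γ i j (σ j r)) (fun j => φ i j r + ε)) < σ i r :=
      nhdsWithin_le_nhds ((hc.tendsto 0).eventually_lt_const
        (by simpa using hS.small_gain r hz i))
    obtain ⟨ε, h₁, h₂⟩ := (h₀.and self_mem_nhdsWithin).exists
    exact ⟨ε, h₂, h₁⟩
  obtain ⟨B, hB⟩ := exists_bound_input h hS (r + 1)
  have hev₁ : ∀ᶠ x in 𝓝 z, lyap V σ x < r + 1 :=
    (hW.tendsto z).eventually_lt_const (by rw [← hr]; exact lt_add_one r)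
  have hev₂ : ∀ᶠ x in 𝓝 z, ∀ j, i ∈ S.Z j → φ i j (lyap V σ x) < φ i j r + ε / 2 :=
    Filter.eventually_all.2 fun j => by
      refine Filter.Eventually.mono (((hS.error_gain i j).continuous.comp hW).tendsto z
        |>.eventually_lt_const (u := φ i j r + ε / 2) ?_) fun _ hx _ => hx
      exact lt_add_of_pos_right _ (half_pos hε)
  have hev₃ : ∀ᶠ x in 𝓝 z, ∀ j, i ∈ S.Z j →
      inv (η i j) (φ i j r + ε / 2) + ‖x j - z j‖₊ < inv (η i j) (φ i j r + ε) :=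
    Filter.eventually_all.2 fun j => by
      by_cases hij : i ∈ S.Z j
      · have hc : Continuous fun x : S.State => inv (η i j) (φ i j r + ε / 2) + ‖x j - z j‖₊ := by
          fun_prop
        refine ((hc.tendsto z).eventually_lt_const ?_).mono fun _ hx _ => hx
        simpa using (isClassKInf_error h hS hij).1.inv_strictMono
          (add_lt_add_right (half_lt_self hε) (φ i j r))
      · exact .of_forall fun _ h' => absurd h' hij
  -- Since g_i may be discontinuous, f_i(x, u) and f_i(z, u) are compared uniformly over a compact
  -- ball of inputs u.
  have hev₄ : ∀ᶠ x in 𝓝 z, ∀ u ∈ Metric.closedBall (0 : EuclideanSpace ℝ (Fin (S.m i))) B,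
      ℓ (S.f i x u) - ℓ (S.f i z u) < α ‖z i‖₊ / 2 := by
    refine (isCompact_closedBall _ _).eventually_forall_of_forall_eventually fun u _ => ?_
    have hc : Continuous fun p : S.State × EuclideanSpace ℝ (Fin (S.m i)) =>
        ℓ (S.f i p.1 p.2) - ℓ (S.f i z p.2) :=
      (ℓ.continuous.comp (S.f_cont i)).sub (ℓ.continuous.comp ((S.f_cont i).comp
        (by fun_prop : Continuous fun p : S.State × EuclideanSpace ℝ (Fin (S.m i)) => (z, p.2))))
    refine (hc.tendsto (z, u)).eventually_lt_const ?_
    have : (0 : ℝ) < α ‖z i‖₊ := hαz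
    simpa using this
  refine ⟨α ‖z i‖₊ / 2, half_pos (by exact_mod_cast hαz), ?_⟩
  filter_upwards [hev₁, hev₂, hev₃, hev₄] with x h₁ h₂ h₃ h₄ q hq
  have herr : ∀ j, η i j ‖S.restrictTo i q z j - z j‖₊ ≤ φ i j r + ε := by
    intro j
    unfold Interconnection.restrictTo
    split_ifs with hij
    · obtain ⟨hη, -⟩ := isClassKInf_error h hS hij
      rw [← hη.le_inv_iff]
      refine le_trans ?_ (h₃ j hij).le
      have h₅ : ‖q j - x j‖₊ ≤ inv (η i j) (φ i j r + ε / 2) :=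
        hη.le_inv_iff.2 ((hq.error_le h hS le_rfl hij).trans (h₂ j hij).le)
      calc ‖q j - z j‖₊ = ‖(q j - x j) + (x j - z j)‖₊ := by rw [sub_add_sub_cancel]
        _ ≤ ‖q j - x j‖₊ + ‖x j - z j‖₊ := nnnorm_add_le _ _
        _ ≤ _ := by gcongr
    · simp [(h.gain_error i j).map_zero]
  have hcond : μ i (pair (fun j => γ i j (V j (z j)))
      (fun j => η i j ‖(S.restrictTo i q z - z) j‖₊)) ≤ V i (z i) := by
    rw [hi]
    refine le_trans ((h.maf i).monotone fun k => ?_) hμε.le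
    rcases k with k | k
    · exact (h.gain_state i k).monotone ((lyap_le_iff hσ).1 le_rfl k)
    · exact herr k
  -- This error vanishes in the components that g_i ignores, yet produces the same input g_i(q).
  have hmain := hdec z (S.restrictTo i q z - z) hcond
  rw [add_sub_cancel, S.g_restrictTo] at hmain
  have h₅ := h₄ (S.g i q) (mem_closedBall_zero_iff.2 (hB x q h₁.le hq i))
  change ℓ (S.f i x (S.g i q)) ≤ _
  linarith

end Lyapunov

/-! ### Trajectories -/

section Trajectory

variable {S : Interconnection N} {V : (i : Fin N) → EuclideanSpace ℝ (Fin (S.n i)) → ℝ≥0}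
  {μ : Fin N → (Fin N ⊕ Fin N → ℝ≥0) → ℝ≥0} {γ η : Fin N → Fin N → ℝ≥0 → ℝ≥0}
  {σ : Fin N → ℝ≥0 → ℝ≥0} {φ : Fin N → Fin N → ℝ≥0 → ℝ≥0}

/-- `x` moves on `[a, b]` with right derivatives given by admissible transmitted states. -/
structure IsTrajectory (S : Interconnection N)
    (V : (i : Fin N) → EuclideanSpace ℝ (Fin (S.n i)) → ℝ≥0)
    (η : Fin N → Fin N → ℝ≥0 → ℝ≥0) (σ : Fin N → ℝ≥0 → ℝ≥0) (φ : Fin N → Fin N → ℝ≥0 → ℝ≥0)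
    (x : ℝ → S.State) (a b : ℝ) : Prop where
  cont : ContinuousOn x (Set.Icc a b)
  deriv : ∀ s ∈ Set.Ico a b, ∃ q, Admissible S V η σ φ (x s) q ∧
    HasDerivWithinAt x (S.field (x s) q) (Set.Ici s) s

theorem IsTrajectory.mono {x : ℝ → S.State} {a b a' b' : ℝ} (hx : IsTrajectory S V η σ φ x a b)
    (ha : a ≤ a') (hb : b' ≤ b) : IsTrajectory S V η σ φ x a' b' :=
  ⟨hx.cont.mono (Set.Icc_subset_Icc ha hb), fun s hs => hx.deriv s (Set.Ico_subset_Ico ha hb hs)⟩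

/-- Continuation along the closed set of times with W ≤ c. Where W = c, components below their bound
stay below by continuity, and those attaining it have negative right derivative. Positivity of c is
needed because there is no strict decay at the origin. -/
theorem IsTrajectory.lyap_le_of_pos (h : ISSLyapunov S V μ γ η) (hS : SmallGain μ γ η σ φ)
    {x : ℝ → S.State} {a b : ℝ} (hx : IsTrajectory S V η σ φ x a b) {c : ℝ≥0} (hc : 0 < c)
    (ha : lyap V σ (x a) ≤ c) {s : ℝ} (hs : s ∈ Set.Icc a b) : lyap V σ (x s) ≤ c := by
  have hσ := hS.omegaPath.kInf
  have hW := continuous_lyap h hσ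
  have hcl : IsClosed ({s | lyap V σ (x s) ≤ c} ∩ Set.Icc a b) := by
    rw [Set.inter_comm]
    exact (hW.comp_continuousOn hx.cont).preimage_isClosed_of_isClosed isClosed_Icc isClosed_Iic
  refine hcl.Icc_subset_of_forall_mem_nhdsWithin ha (fun s hs => ?_) hs
  obtain ⟨hsc, hs⟩ := hs
  obtain ⟨q, hq, hd⟩ := hx.deriv s hs
  have hcs : Filter.Tendsto x (𝓝[>] s) (𝓝 (x s)) :=
    hd.continuousWithinAt.mono_left (nhdsWithin_mono _ Set.Ioi_subset_Ici_self)
  change ∀ᶠ t in 𝓝[>] s, lyap V σ (x t) ≤ c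
  rcases lt_or_eq_of_le (show lyap V σ (x s) ≤ c from hsc) with hlt | rfl
  · exact (((hW.tendsto _).comp hcs).eventually_lt_const hlt).mono fun _ ht => le_of_lt ht
  · simp_rw [lyap_le_iff hσ]
    refine Filter.eventually_all.2 fun i => ?_
    rcases lt_or_eq_of_le ((lyap_le_iff hσ).1 le_rfl i) with hlt | heq
    · exact ((((h.continuous i).comp (continuous_apply i)).tendsto _).comp hcs
        |>.eventually_lt_const hlt).mono fun _ ht => le_of_lt ht
    · obtain ⟨α, hα, hev⟩ := eventually_decay h hS hc heq
      have hdec := hev.self_of_nhds q hq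
      have hdV : HasDerivWithinAt (fun t => (V i (x t i) : ℝ))
          (fderiv ℝ (fun y => (V i y : ℝ)) (x s i) (S.field (x s) q i)) (Set.Ici s) s :=
        HasFDerivAt.comp_hasDerivWithinAt (l := fun y => (V i y : ℝ)) s
          (h.differentiable i (x s i)).hasFDerivAt (hasDerivWithinAt_pi.1 hd i)
      have hsl := hdV.limsup_slope_le (show _ < (0 : ℝ) by linarith)
      rw [Set.Ici_sdiff_left] at hsl
      filter_upwards [hsl, self_mem_nhdsWithin] with t ht hst
      rw [← heq]
      have hst' : s < t := hst
      rw [slope_def_field, div_lt_iff₀ (sub_pos.2 hst'), zero_mul, sub_neg] at ht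
      exact_mod_cast ht.le

theorem IsTrajectory.lyap_le (h : ISSLyapunov S V μ γ η) (hS : SmallGain μ γ η σ φ)
    {x : ℝ → S.State} {a b : ℝ} (hx : IsTrajectory S V η σ φ x a b)
    {s : ℝ} (hs : s ∈ Set.Icc a b) : lyap V σ (x s) ≤ lyap V σ (x a) :=
  le_of_forall_gt_imp_ge_of_dense fun _ hc =>
    hx.lyap_le_of_pos h hS (zero_le.trans_lt hc) hc.le hs

theorem IsTrajectory.norm_sub_le {x : ℝ → S.State} {a b : ℝ} (h : ISSLyapunov S V μ γ η)
    (hS : SmallGain μ γ η σ φ) (hx : IsTrajectory S V η σ φ x a b) {C L : ℝ≥0}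
    (hL : ∀ x q : S.State, lyap V σ x ≤ C → Admissible S V η σ φ x q → ‖S.field x q‖₊ ≤ L)
    (ha : lyap V σ (x a) ≤ C) {s : ℝ} (hs : s ∈ Set.Icc a b) : ‖x s - x a‖ ≤ L * (s - a) := by
  choose! q hq hd using hx.deriv
  refine norm_image_sub_le_of_norm_deriv_right_le_segment hx.cont hd (fun t ht => ?_) s hs
  exact hL _ _ ((hx.lyap_le h hS (Set.Ico_subset_Icc_self ht)).trans ha) (hq t ht)

/-- Near `z`, each component of the Lyapunov function drops below its maximal value at `z`. -/
theorem eventually_component_le (h : ISSLyapunov S V μ γ η) (hS : SmallGain μ γ η σ φ)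
    {z : S.State} (hz : 0 < lyap V σ z) (i : Fin N) :
    ∀ᶠ δ in 𝓝[>] (0 : ℝ), ∃ m : ℝ, m < σ i (lyap V σ z) ∧ ∀ᶠ p in 𝓝 z, ∀ (x : ℝ → S.State) (a : ℝ),
      IsTrajectory S V η σ φ x a (a + δ) → x a = p → V i (x (a + δ) i) ≤ m := by
  set r := lyap V σ z with hr
  have hσ := hS.omegaPath.kInf
  have hW := continuous_lyap h hσ
  obtain ⟨L, hL⟩ := exists_bound_field h hS (r + 1)
  have hWr : ∀ᶠ p in 𝓝 z, lyap V σ p < r + 1 :=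
    (hW.tendsto z).eventually_lt_const (by rw [← hr]; exact lt_add_one r)
  have hnear : ∀ δ : ℝ, 0 < δ → ∀ᶠ p in 𝓝 z, ‖p - z‖ < δ := fun δ hδ => by
    filter_upwards [Metric.ball_mem_nhds z hδ] with p hp
    simpa [dist_eq_norm] using hp
  have hL1 : (0 : ℝ) < L + 1 := by positivity
  -- a trajectory starting close to `z` stays close to `z`
  have hstay : ∀ δ : ℝ, 0 < δ → ∀ x : ℝ → S.State, ∀ a,
      IsTrajectory S V η σ φ x a (a + δ) → lyap V σ (x a) < r + 1 → ‖x a - z‖ < δ →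
      ∀ s ∈ Set.Icc a (a + δ), ‖x s - z‖ < (L + 1) * δ := by
    intro δ hδ x a hx hxa hxz s hs
    have h₁ := hx.norm_sub_le h hS hL hxa.le hs
    have h₂ : (L : ℝ) * (s - a) ≤ L * δ := by
      have := hs.2
      gcongr
      linarith
    calc ‖x s - z‖ = ‖(x s - x a) + (x a - z)‖ := by rw [sub_add_sub_cancel]
      _ ≤ ‖x s - x a‖ + ‖x a - z‖ := norm_add_le _ _
      _ < (L + 1) * δ := by linarith
  have hsmall : ∀ R : ℝ, 0 < R → ∀ᶠ δ in 𝓝[>] (0 : ℝ), (L + 1) * δ < R := fun R hR => by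
    have hc : Continuous fun δ : ℝ => ((L : ℝ) + 1) * δ := by fun_prop
    exact nhdsWithin_le_nhds ((hc.tendsto 0).eventually_lt_const (by simpa using hR))
  rcases lt_or_eq_of_le ((lyap_le_iff hσ).1 hr.ge i) with hlt | heq
  · obtain ⟨m, hm₁, hm₂⟩ := exists_between hlt
    have hev : ∀ᶠ p in 𝓝 z, V i (p i) < m :=
      (((h.continuous i).comp (continuous_apply i)).tendsto z).eventually_lt_const hm₁
    obtain ⟨R, hR, hRm⟩ := Metric.eventually_nhds_iff.1 hev
    filter_upwards [hsmall R hR, self_mem_nhdsWithin] with δ hδR hδ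
    refine ⟨m, by exact_mod_cast hm₂, ?_⟩
    filter_upwards [hWr, hnear δ hδ] with p hp₁ hp₂ x a hx hxa
    subst hxa
    have hδ' : 0 < δ := hδ
    have := hstay δ hδ x a hx hp₁ hp₂ (a + δ) ⟨by linarith, le_rfl⟩
    exact_mod_cast (hRm (by rw [dist_eq_norm]; exact this.trans hδR)).le
  · obtain ⟨α, hα, hev⟩ := eventually_decay h hS hz heq
    set ℓ := fderiv ℝ (fun y => (V i y : ℝ)) (z i) with hℓ
    -- The tolerance is chosen so that at distance at most (L + 1)δ the linearization error is at
    -- most αδ/4.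
    have hdiff : ∀ᶠ p in 𝓝 z, ‖(V i (p i) : ℝ) - V i (z i) - ℓ (p i - z i)‖ ≤
        α / (4 * (L + 1)) * ‖p i - z i‖ :=
      ((continuous_apply i).tendsto z).eventually
        ((h.differentiable i (z i)).hasFDerivAt.isLittleO.def (by positivity))
    obtain ⟨R, hR, hRm⟩ := Metric.eventually_nhds_iff.1 (hev.and hdiff)
    filter_upwards [hsmall R hR, self_mem_nhdsWithin] with δ hδR hδ
    have hδ' : 0 < δ := hδ
    -- The drift contributes at most -αδ, the initial offset and the linearization error at most
    -- αδ/4 each; the total -αδ/2 is below -αδ/4.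
    refine ⟨V i (z i) - α * δ / 4, by rw [← heq]; linarith [mul_pos hα hδ'], ?_⟩
    have hℓp : ∀ᶠ p in 𝓝 z, ℓ (p i - z i) < α * δ / 4 := by
      have hc : Continuous fun p : S.State => ℓ (p i - z i) := by fun_prop
      refine (hc.tendsto z).eventually_lt_const ?_
      simpa using mul_pos hα hδ'
    filter_upwards [hWr, hnear δ hδ, hℓp] with p hp₁ hp₂ hp₃ x a hx hxa
    subst hxa
    have hst := hstay δ hδ x a hx hp₁ hp₂
    have hend : a + δ ∈ Set.Icc a (a + δ) := ⟨by linarith, le_rfl⟩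
    choose! q hq hd using hx.deriv
    -- Following the fixed linear form ℓ instead of V_i avoids any continuity of the gradient.
    have hlin : ℓ (x (a + δ) i) ≤ ℓ (x a i) + -α * (a + δ - a) := by
      refine image_le_of_deriv_right_le_deriv_boundary (f := fun s => ℓ (x s i))
        (f' := fun s => ℓ (S.field (x s) (q s) i)) (B := fun s => ℓ (x a i) + -α * (s - a))
        (B' := fun _ => -α) (a := a) (b := a + δ) ?_ ?_ ?_ ?_ ?_ ?_ hend
      · exact ℓ.continuous.comp_continuousOn ((continuous_apply i).comp_continuousOn hx.cont)
      · exact fun s hs => ℓ.hasFDerivAt.comp_hasDerivWithinAt s (hasDerivWithinAt_pi.1 (hd s hs) i)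
      · simp
      · fun_prop
      · intro s _
        simpa using (((hasDerivWithinAt_id s (Set.Ici s)).sub_const a).const_mul (-α)).const_add
          (ℓ (x a i))
      · intro s hs
        have hs' := Set.Ico_subset_Icc_self hs
        exact (hRm (by rw [dist_eq_norm]; exact (hst s hs').trans hδR)).1 _ (hq s hs)
    have hfin := (hRm (by rw [dist_eq_norm]; exact (hst _ hend).trans hδR)).2
    have hni : ‖x (a + δ) i - z i‖ ≤ (L + 1) * δ :=
      (norm_le_pi_norm (x (a + δ) - z) i).trans (hst _ hend).le
    have herr : α / (4 * (L + 1)) * ‖x (a + δ) i - z i‖ ≤ α * δ / 4 := by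
      calc α / (4 * (L + 1)) * ‖x (a + δ) i - z i‖ ≤ α / (4 * (L + 1)) * ((L + 1) * δ) := by
            gcongr
        _ = α * δ / 4 := by field_simp
    have h₁ := (Real.le_norm_self _).trans (hfin.trans herr)
    rw [map_sub] at h₁ hp₃
    linarith [mul_pos hα hδ']

/-- Near a point `z ≠ 0`, trajectories of some common length decrease the Lyapunov function. -/
theorem eventually_lyap_add_le (h : ISSLyapunov S V μ γ η) (hS : SmallGain μ γ η σ φ)
    {z : S.State} (hz : 0 < lyap V σ z) :
    ∃ δ : ℝ, 0 < δ ∧ ∃ p : ℝ≥0, 0 < p ∧ ∀ᶠ y in 𝓝 z, ∀ (x : ℝ → S.State) (a : ℝ),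
      IsTrajectory S V η σ φ x a (a + δ) → x a = y →
        lyap V σ (x (a + δ)) + p ≤ lyap V σ y := by
  set r := lyap V σ z with hr
  have hσ := hS.omegaPath.kInf
  have hW := continuous_lyap h hσ
  obtain ⟨δ, hδ, hδ₀⟩ := ((Filter.eventually_all.2 (eventually_component_le h hS hz)).and
    self_mem_nhdsWithin).exists
  choose m hm hev using hδ
  -- A negative m i is truncated to 0, which is harmless as σ_i(r) > 0. The gap between r' and r is
  -- split at c: final values lie below r', initial ones above c.
  let r' : ℝ≥0 := Finset.univ.sup fun i => inv (σ i) (m i).toNNReal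
  have hr' : r' < r := by
    refine (Finset.sup_lt_iff hz).2 fun i _ => (hσ i).inv_lt_iff.2 ?_
    rw [← NNReal.coe_lt_coe, Real.coe_toNNReal']
    exact max_lt (hm i) ((hσ i).pos hz)
  obtain ⟨c, hc₁, hc₂⟩ := exists_between hr'
  refine ⟨δ, hδ₀, c - r', tsub_pos_of_lt hc₁, ?_⟩
  filter_upwards [Filter.eventually_all.2 hev, (hW.tendsto z).eventually_const_lt hc₂]
    with y hy hcy x a hx hxa
  have h₁ : lyap V σ (x (a + δ)) ≤ r' := (lyap_le_iff hσ).2 fun i => by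
    rw [← (hσ i).inv_le_iff]
    refine le_trans ((hσ i).inv_strictMono.monotone ?_)
      (Finset.le_sup (f := fun i => inv (σ i) (m i).toNNReal) (Finset.mem_univ i))
    exact NNReal.le_toNNReal_of_coe_le (hy i x a hx hxa)
  calc lyap V σ (x (a + δ)) + (c - r') ≤ r' + (c - r') := by gcongr
    _ = c := add_tsub_cancel_of_le hc₁.le
    _ ≤ lyap V σ y := hcy.le

/-- Uniform decrease of the Lyapunov function on compact sets not containing the origin. -/
theorem exists_uniform_decrease (h : ISSLyapunov S V μ γ η) (hS : SmallGain μ γ η σ φ)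
    {K : Set S.State} (hK : IsCompact K) (hpos : ∀ z ∈ K, 0 < lyap V σ z) :
    ∃ δ : ℝ, 0 < δ ∧ ∃ p : ℝ≥0, 0 < p ∧ ∀ (x : ℝ → S.State) (a : ℝ), x a ∈ K →
      IsTrajectory S V η σ φ x a (a + δ) → lyap V σ (x (a + δ)) + p ≤ lyap V σ (x a) := by
  -- A longer time keeps the loss, W being nonincreasing; thus two sets are merged with the larger δ
  -- and the smaller p.
  have hext : ∀ {δ δ' : ℝ} {p p' : ℝ≥0} {x : ℝ → S.State} {a : ℝ}, 0 < δ → δ ≤ δ' → p' ≤ p →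
      (IsTrajectory S V η σ φ x a (a + δ) → lyap V σ (x (a + δ)) + p ≤ lyap V σ (x a)) →
      IsTrajectory S V η σ φ x a (a + δ') → lyap V σ (x (a + δ')) + p' ≤ lyap V σ (x a) := by
    intro δ δ' p p' x a hδ hδδ' hpp' hd hx
    refine le_trans (add_le_add ?_ hpp') (hd (hx.mono le_rfl (by linarith)))
    exact (hx.mono (a' := a + δ) (by linarith) le_rfl).lyap_le h hS ⟨by linarith, le_rfl⟩
  refine hK.induction_on (p := fun K => ∃ δ : ℝ, 0 < δ ∧ ∃ p : ℝ≥0, 0 < p ∧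
    ∀ (x : ℝ → S.State) (a : ℝ), x a ∈ K →
      IsTrajectory S V η σ φ x a (a + δ) → lyap V σ (x (a + δ)) + p ≤ lyap V σ (x a))
    ?_ ?_ ?_ ?_
  · exact ⟨1, one_pos, 1, one_pos, fun _ _ hx => absurd hx (Set.notMem_empty _)⟩
  · rintro s t hst ⟨δ, hδ, p, hp, H⟩
    exact ⟨δ, hδ, p, hp, fun x a hx => H x a (hst hx)⟩
  · rintro s t ⟨δ₁, hδ₁, p₁, hp₁, H₁⟩ ⟨δ₂, hδ₂, p₂, hp₂, H₂⟩
    refine ⟨max δ₁ δ₂, lt_max_of_lt_left hδ₁, min p₁ p₂, lt_min hp₁ hp₂, fun x a hx => ?_⟩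
    rcases hx with hx | hx
    · exact hext hδ₁ (le_max_left _ _) (min_le_left _ _) (H₁ x a hx)
    · exact hext hδ₂ (le_max_right _ _) (min_le_right _ _) (H₂ x a hx)
  · intro z hz
    obtain ⟨δ, hδ, p, hp, H⟩ := eventually_lyap_add_le h hS (hpos z hz)
    exact ⟨_, nhdsWithin_le_nhds H, δ, hδ, p, hp, fun x a hx hT => hx x a hT rfl⟩

/-- Trajectories in a sublevel set reach a smaller one in uniformly bounded time. -/
theorem exists_time_lyap_le (h : ISSLyapunov S V μ γ η) (hS : SmallGain μ γ η σ φ) {c : ℝ≥0}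
    (hc : 0 < c) (C : ℝ≥0) :
    ∃ τ : ℝ, 0 < τ ∧ ∀ (x : ℝ → S.State) (a b : ℝ), a + τ ≤ b → IsTrajectory S V η σ φ x a b →
      lyap V σ (x a) ≤ C → lyap V σ (x b) ≤ c := by
  have hσ := hS.omegaPath.kInf
  have hW := continuous_lyap h hσ
  obtain ⟨β, -, -, hβ⟩ := exists_norm_le_of_lyap_le h hσ
  let K : Set S.State := lyap V σ ⁻¹' Set.Icc c C
  have hK : IsCompact K :=
    (isCompact_closedBall (0 : S.State) (β C)).of_isClosed_subset (isClosed_Icc.preimage hW)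
      fun x hx => mem_closedBall_zero_iff.2 (hβ x C hx.2).2
  obtain ⟨δ, hδ, p, hp, H⟩ := exists_uniform_decrease h hS hK fun z hz => hc.trans_le hz.1
  -- After n steps of length δ, either W ≤ c was reached or n losses of p have accumulated; the
  -- latter is impossible once n * p > C.
  have key : ∀ (x : ℝ → S.State) (a : ℝ) (n : ℕ), IsTrajectory S V η σ φ x a (a + n * δ) →
      lyap V σ (x a) ≤ C → lyap V σ (x (a + n * δ)) ≤ c ∨ lyap V σ (x (a + n * δ)) + n * p ≤ C := by
    intro x a n
    induction n with
    | zero => intro _ hx; right; simpa using hx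
    | succ n ih =>
      intro hx hxC
      have hn : (0 : ℝ) ≤ n * δ := by positivity
      have hsucc : a + ((n + 1 : ℕ) : ℝ) * δ = a + n * δ + δ := by push_cast; ring
      rw [hsucc] at hx ⊢
      have hlast := hx.mono (a' := a + n * δ) (by linarith) le_rfl
      have hle := hlast.lyap_le h hS (s := a + n * δ + δ) ⟨by linarith, le_rfl⟩
      by_cases hcn : lyap V σ (x (a + n * δ)) ≤ c
      · exact .inl (hle.trans hcn)
      · right
        have h₁ := (ih (hx.mono le_rfl (by linarith)) hxC).resolve_left hcn
        have h₂ := H x _ ⟨(not_le.1 hcn).le, le_trans le_self_add h₁⟩ hlast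
        push_cast
        calc lyap V σ (x (a + n * δ + δ)) + (n + 1) * p
            = lyap V σ (x (a + n * δ + δ)) + p + n * p := by ring
          _ ≤ lyap V σ (x (a + n * δ)) + n * p := by gcongr
          _ ≤ C := h₁
  obtain ⟨n, hn⟩ := exists_nat_gt (C / p)
  have hnp : C < n * p := (div_lt_iff₀ hp).1 hn
  have hn0 : n ≠ 0 := by
    rintro rfl
    simp at hnp
  refine ⟨n * δ, by positivity, fun x a b hab hx hxC => ?_⟩
  have hnδ : (0 : ℝ) ≤ n * δ := by positivity
  refine ((hx.mono (a' := a + n * δ) (by linarith) le_rfl).lyap_le h hS ⟨hab, le_rfl⟩).trans ?_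
  refine (key x a n (hx.mono le_rfl hab) hxC).resolve_right fun h₁ => ?_
  exact (hnp.trans_le (le_trans le_add_self h₁)).false

end Trajectory

/-! ### Solutions of the event-triggered closed loop -/

namespace ClosedLoopSolution

/-! ### Event times. -/

section Times

variable {S : Interconnection N}
  {T : (i : Fin N) → EuclideanSpace ℝ (Fin (S.n i)) → EuclideanSpace ℝ (Fin (S.n i)) → ℝ}
  (R : ClosedLoopSolution S T)

theorem monotone_t : Monotone R.t := by
  refine monotone_nat_of_le_succ fun k => ?_
  rw [R.t_succ]
  refine le_sInf ?_
  rintro _ ⟨s, ⟨hs, -⟩, rfl⟩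
  exact hs.le

theorem t_nonneg (k : ℕ) : 0 ≤ R.t k := R.t_zero ▸ R.monotone_t (Nat.zero_le k)

theorem exists_t_eq_coe {k : ℕ} {s : ℝ} (hs : R.t k ≤ s) :
    ∃ τ : ℝ, R.t k = τ ∧ 0 ≤ τ ∧ τ ≤ s := by
  have h₀ := R.t_nonneg k
  generalize R.t k = u at hs h₀
  induction u with
  | bot => simp at h₀
  | top => simp at hs
  | coe τ => exact ⟨τ, rfl, by exact_mod_cast h₀, by exact_mod_cast hs⟩

/-- After `t k` this is the infimum property. At `t k` itself the error is zero initially, and at an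
event every transmitting system has just been reset. -/
theorem not_transmits {k : ℕ} {s : ℝ} (h₁ : R.t k ≤ s) (h₂ : (s : EReal) < R.t (k + 1))
    (h₃ : (s : EReal) < R.b k) (i : Fin N) :
    ¬ Transmits S T i (R.y k s i) (R.q k i - R.y k s i) := by
  intro hT
  rcases h₁.lt_or_eq with h₁ | h₁
  · rw [R.t_succ] at h₂
    exact h₂.not_ge (sInf_le ⟨s, ⟨h₁, h₃, i, hT⟩, rfl⟩)
  · cases k with
    | zero =>
      rw [R.t_zero] at h₁
      have hs : s = 0 := by exact_mod_cast h₁.symm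
      subst hs
      exact hT.2 (by rw [R.q_zero, sub_self])
    | succ k =>
      rw [R.y_succ k s h₁, R.q_succ k s h₁] at hT
      split_ifs at hT with h
      · exact hT.2 (sub_self _)
      · exact h hT

theorem exists_lt_t (hZ : ¬ R.IsZeno) (s : ℝ) : ∃ n, (s : EReal) < R.t n := by
  have hlim := tendsto_atTop_iSup R.monotone_t
  have h₀ : 0 ≤ ⨆ k, R.t k := (R.t_nonneg 0).trans (le_iSup R.t 0)
  generalize (⨆ k, R.t k) = u at hlim h₀
  induction u with
  | bot => simp at h₀
  | top => exact (hlim.eventually_const_lt (EReal.coe_lt_top s)).exists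
  | coe τ => exact absurd ⟨τ, hlim⟩ hZ

/-- Event times may coincide; the least index beyond s singles out a nondegenerate interval. This
half-open form serves right derivatives, the opposite one below left continuity. -/
theorem exists_t_le_lt (hZ : ¬ R.IsZeno) {s : ℝ} (hs : 0 ≤ s) :
    ∃ k, R.t k ≤ s ∧ (s : EReal) < R.t (k + 1) := by
  classical
  have h := R.exists_lt_t hZ s
  obtain ⟨k, hk⟩ : ∃ k, Nat.find h = k + 1 := Nat.exists_eq_succ_of_ne_zero fun h₀ => by
    have := Nat.find_spec h
    rw [h₀, R.t_zero] at this
    exact absurd hs (not_le.2 (by exact_mod_cast this))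
  exact ⟨k, not_lt.1 (Nat.find_min h (by omega)), hk ▸ Nat.find_spec h⟩

theorem exists_t_lt_le (hZ : ¬ R.IsZeno) {s : ℝ} (hs : 0 < s) :
    ∃ k, R.t k < s ∧ (s : EReal) ≤ R.t (k + 1) := by
  classical
  have h : ∃ n, (s : EReal) ≤ R.t n := (R.exists_lt_t hZ s).imp fun _ hn => hn.le
  obtain ⟨k, hk⟩ : ∃ k, Nat.find h = k + 1 := Nat.exists_eq_succ_of_ne_zero fun h₀ => by
    have := Nat.find_spec h
    rw [h₀, R.t_zero] at this
    exact absurd hs (not_lt.2 (by exact_mod_cast this))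
  exact ⟨k, not_le.1 (Nat.find_min h (by omega)), hk ▸ Nat.find_spec h⟩

end Times

/-! ### Closed-loop solutions as trajectories. -/

section Stability

variable {S : Interconnection N} {V : (i : Fin N) → EuclideanSpace ℝ (Fin (S.n i)) → ℝ≥0}
  {μ : Fin N → (Fin N ⊕ Fin N → ℝ≥0) → ℝ≥0} {γ η : Fin N → Fin N → ℝ≥0 → ℝ≥0}
  {σ : Fin N → ℝ≥0 → ℝ≥0} {φ : Fin N → Fin N → ℝ≥0 → ℝ≥0}

theorem chi_zero (h : ISSLyapunov S V μ γ η) (hS : SmallGain μ γ η σ φ) (j : Fin N) :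
    chi S η σ φ j 0 = 0 := by
  have h₀ : ((S.Z j).sup fun i => inv (φ i j) (η i j 0)) = 0 := by
    rw [← bot_eq_zero, Finset.sup_eq_bot_iff]
    intro i hi
    obtain ⟨hη, hφ⟩ := isClassKInf_error h hS hi
    rw [bot_eq_zero, hη.map_zero, hφ.inv_zero]
  rw [chi, h₀, (hS.omegaPath.kInf j).map_zero]

theorem admissible_of_not_transmits (h : ISSLyapunov S V μ γ η) (hS : SmallGain μ γ η σ φ)
    {x q : S.State} (hxq : ∀ i, ¬ Transmits S (trigFun S V η σ φ) i (x i) (q i - x i)) :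
    Admissible S V η σ φ x q := by
  intro j
  by_cases he : q j - x j = 0
  · rw [he, nnnorm_zero, chi_zero h hS]
    exact zero_le
  · have : ¬ 0 ≤ trigFun S V η σ φ j (x j) (q j - x j) := fun h₀ => hxq j ⟨h₀, he⟩
    rw [trigFun, not_le, sub_neg] at this
    exact_mod_cast this.le

variable (R : ClosedLoopSolution S (trigFun S V η σ φ))

theorem isTrajectory_flow (h : ISSLyapunov S V μ γ η) (hS : SmallGain μ γ η σ φ) {k : ℕ} {τ u : ℝ}
    (hτ : R.t k = τ) (hu : (u : EReal) ≤ R.t (k + 1)) (hb : (u : EReal) < R.b k) :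
    IsTrajectory S V η σ φ (R.y k) τ u := by
  obtain ⟨⟨-, hd⟩, -⟩ := R.flow k τ hτ
  refine ⟨fun s hs => ?_, fun s hs => ⟨R.q k, ?_, ?_⟩⟩
  · exact (hd s hs.1 ((EReal.coe_le_coe_iff.2 hs.2).trans_lt hb)).continuousWithinAt.mono
      Set.Icc_subset_Ici_self
  · have hsu : (s : EReal) < u := EReal.coe_lt_coe_iff.2 hs.2
    exact admissible_of_not_transmits h hS (R.not_transmits (by rw [hτ]; exact_mod_cast hs.1)
      (hsu.trans_le hu) (hsu.trans hb))
  · exact (hd s hs.1 ((EReal.coe_lt_coe_iff.2 hs.2).trans hb)).mono (Set.Ici_subset_Ici.2 hs.1)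

theorem b_eq_top (h : ISSLyapunov S V μ γ η) (hS : SmallGain μ γ η σ φ) {k : ℕ} {τ : ℝ}
    (hτ : R.t k = τ) (ht : R.t (k + 1) = ⊤) : R.b k = ⊤ := by
  obtain ⟨L, hL⟩ := exists_bound_field h hS (lyap V σ (R.y k τ))
  refine (R.flow k τ hτ).eq_top_of_bounded (L := L) (S.continuous_field (R.q k)) fun s hs hsb => ?_
  refine hL _ _ ((R.isTrajectory_flow h hS hτ (by simp [ht]) hsb).lyap_le h hS ⟨hs, le_rfl⟩) ?_
  exact admissible_of_not_transmits h hS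
    (R.not_transmits (by rw [hτ]; exact_mod_cast hs) (by simp [ht]) hsb)

/-- If a further event occurs, some transmission time at or after it lies in the flow's interval. If
none occurs, the state stays in a sublevel set and the flow is global. -/
theorem lt_b (h : ISSLyapunov S V μ γ η) (hS : SmallGain μ γ η σ φ) {k : ℕ} {s : ℝ}
    (h₁ : R.t k ≤ s) (h₂ : (s : EReal) ≤ R.t (k + 1)) : (s : EReal) < R.b k := by
  obtain ⟨τ, hτ, -⟩ := R.exists_t_eq_coe h₁
  by_cases ht : R.t (k + 1) = ⊤
  · rw [R.b_eq_top h hS hτ ht]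
    exact EReal.coe_lt_top s
  · have ht' : R.t (k + 1) < ⊤ := lt_top_iff_ne_top.2 ht
    rw [R.t_succ, sInf_lt_iff] at ht'
    obtain ⟨_, ⟨s', hs', rfl⟩, -⟩ := ht'
    refine h₂.trans_lt (lt_of_le_of_lt ?_ hs'.2.1)
    rw [R.t_succ]
    exact sInf_le ⟨s', hs', rfl⟩

theorem x_eq_flow (h : ISSLyapunov S V μ γ η) (hS : SmallGain μ γ η σ φ) {k : ℕ} {s : ℝ}
    (h₁ : R.t k ≤ s) (h₂ : (s : EReal) ≤ R.t (k + 1)) : R.x s = R.y k s :=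
  R.x_eq k s h₁ h₂ (R.lt_b h hS h₁ h₂)

theorem exists_hasDerivWithinAt (h : ISSLyapunov S V μ γ η) (hS : SmallGain μ γ η σ φ)
    (hZ : ¬ R.IsZeno) {s : ℝ} (hs : 0 ≤ s) :
    ∃ q, Admissible S V η σ φ (R.x s) q ∧
      HasDerivWithinAt R.x (S.field (R.x s) q) (Set.Ici s) s := by
  obtain ⟨k, hk, hk'⟩ := R.exists_t_le_lt hZ hs
  obtain ⟨τ, hτ, -, hτs⟩ := R.exists_t_eq_coe hk
  have hb := R.lt_b h hS hk hk'.le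
  have hx := R.x_eq_flow h hS hk hk'.le
  refine ⟨R.q k, ?_, ?_⟩
  · rw [hx]
    exact admissible_of_not_transmits h hS (R.not_transmits hk hk' hb)
  · have hd : HasDerivWithinAt (R.y k) (S.field (R.y k s) (R.q k)) (Set.Ici s) s :=
      ((R.flow k τ hτ).1.2 s hτs hb).mono (Set.Ici_subset_Ici.2 hτs)
    rw [← hx] at hd
    refine hd.congr_of_eventuallyEq ?_ hx
    have hev : ∀ᶠ r : ℝ in 𝓝 s, (r : EReal) < R.t (k + 1) :=
      (continuous_coe_real_ereal.tendsto s).eventually_lt_const hk'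
    filter_upwards [self_mem_nhdsWithin, nhdsWithin_le_nhds hev] with r hr hr'
    exact R.x_eq_flow h hS (hk.trans (EReal.coe_le_coe_iff.2 hr)) hr'.le

theorem continuousWithinAt_Iic (h : ISSLyapunov S V μ γ η) (hS : SmallGain μ γ η σ φ)
    (hZ : ¬ R.IsZeno) {s : ℝ} (hs : 0 < s) : ContinuousWithinAt R.x (Set.Iic s) s := by
  obtain ⟨k, hk, hk'⟩ := R.exists_t_lt_le hZ hs
  obtain ⟨τ, hτ, -, -⟩ := R.exists_t_eq_coe hk.le
  have hτs : τ < s := by rw [hτ] at hk; exact_mod_cast hk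
  have hc := ((R.flow k τ hτ).1.2 s hτs.le (R.lt_b h hS hk.le hk')).continuousWithinAt.continuousAt
    (Ici_mem_nhds hτs)
  refine hc.continuousWithinAt.congr_of_eventuallyEq ?_ (R.x_eq_flow h hS hk.le hk')
  filter_upwards [self_mem_nhdsWithin, nhdsWithin_le_nhds (Ioi_mem_nhds hτs)] with r hr hr'
  exact R.x_eq_flow h hS (by rw [hτ]; exact_mod_cast (le_of_lt hr'))
    ((EReal.coe_le_coe_iff.2 hr).trans hk')

/-- Events change only the transmitted state: x is continuous across them and has the right
derivative prescribed by the new value. -/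
theorem isTrajectory (h : ISSLyapunov S V μ γ η) (hS : SmallGain μ γ η σ φ)
    (hZ : ¬ R.IsZeno) {a b : ℝ} (ha : 0 ≤ a) : IsTrajectory S V η σ φ R.x a b := by
  refine ⟨fun s hs => ?_, fun s hs => R.exists_hasDerivWithinAt h hS hZ (ha.trans hs.1)⟩
  obtain ⟨q, -, hd⟩ := R.exists_hasDerivWithinAt h hS hZ (ha.trans hs.1)
  rcases (ha.trans hs.1).eq_or_lt with h₀ | h₀
  · exact hd.continuousWithinAt.mono fun r hr => h₀ ▸ ha.trans hr.1
  · have hc := (R.continuousWithinAt_Iic h hS hZ h₀).union hd.continuousWithinAt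
    rw [Set.Iic_union_Ici] at hc
    exact hc.mono (Set.subset_univ _)

theorem dom_eq (h : ISSLyapunov S V μ γ η) (hS : SmallGain μ γ η σ φ) (hZ : ¬ R.IsZeno) :
    R.dom = Set.Ici 0 := by
  ext s
  constructor
  · rintro ⟨k, hk, -⟩
    have := (R.t_nonneg k).trans hk
    exact_mod_cast this
  · intro hs
    obtain ⟨k, hk, hk'⟩ := R.exists_t_le_lt hZ hs
    exact ⟨k, hk, hk'.le, R.lt_b h hS hk hk'.le⟩

end Stability

end ClosedLoopSolution

end EventTriggered

end

/-! ### Global uniform asymptotic stability. -/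

open EventTriggered in
theorem mainTheorem1 {N : ℕ} (S : Interconnection N)
    (V : (i : Fin N) → EuclideanSpace ℝ (Fin (S.n i)) → ℝ≥0)
    (μ : Fin N → (Fin N ⊕ Fin N → ℝ≥0) → ℝ≥0)
    (γ η : Fin N → Fin N → ℝ≥0 → ℝ≥0)
    (σ : Fin N → ℝ≥0 → ℝ≥0)
    (φ : Fin N → Fin N → ℝ≥0 → ℝ≥0)
    (hISS : ISSLyapunov S V μ γ η)
    (hSG : SmallGain μ γ η σ φ) :
    IsGUAS {R : ClosedLoopSolution S (trigFun S V η σ φ) | ¬ R.IsZeno} := by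
  have hσ := hSG.omegaPath.kInf
  obtain ⟨β₁, hβ₁, hβ₁₀, hup⟩ := exists_norm_le_of_lyap_le hISS hσ
  obtain ⟨β₂, hβ₂, hβ₂₀, hlow⟩ := exists_lyap_le_of_norm_le hISS hσ
  have hmono : ∀ R : ClosedLoopSolution S (trigFun S V η σ φ), ¬ R.IsZeno → ∀ t₀ t : ℝ, 0 ≤ t₀ →
      t₀ ≤ t → lyap V σ (R.x t) ≤ lyap V σ (R.x t₀) := fun R hR t₀ t h₀ ht =>
    (R.isTrajectory hISS hSG hR h₀ (b := t)).lyap_le hISS hSG ⟨ht, le_rfl⟩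
  have hsmall : ∀ ε : ℝ, 0 < ε → ∃ c : ℝ≥0, 0 < c ∧ ∀ x : S.State, lyap V σ x ≤ c →
      S.euclNorm x ≤ ε := by
    intro ε hε
    have hev : ∀ᶠ c in 𝓝[>] (0 : ℝ≥0), β₁ c < ε :=
      nhdsWithin_le_nhds ((hβ₁.tendsto 0).eventually_lt_const (by rwa [hβ₁₀]))
    obtain ⟨c, hc, hc₀⟩ := (hev.and self_mem_nhdsWithin).exists
    exact ⟨c, hc₀, fun x hx => (hup x c hx).1.trans hc.le⟩
  refine ⟨fun R hR => R.dom_eq hISS hSG hR, ?_, ?_, ?_, ?_⟩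
  · intro R hR h₀ t ht
    have h₁ : lyap V σ (R.x 0) ≤ 0 := by
      have := hlow (R.x 0) 0 (by simp [h₀, Interconnection.euclNorm])
      rwa [hβ₂₀] at this
    have h₂ := (hup _ 0 ((hmono R hR 0 t le_rfl ht).trans h₁)).2
    rw [hβ₁₀] at h₂
    exact norm_le_zero_iff.1 h₂
  · intro ε hε
    obtain ⟨c, hc, hcε⟩ := hsmall ε hε
    have hev : ∀ᶠ δ in 𝓝[>] (0 : ℝ≥0), β₂ δ < c :=
      nhdsWithin_le_nhds ((hβ₂.tendsto 0).eventually_lt_const (by rwa [hβ₂₀]))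
    obtain ⟨δ, hδ, hδ₀⟩ := (hev.and self_mem_nhdsWithin).exists
    exact ⟨δ, hδ₀, fun R hR t₀ t h₀ ht hx =>
      hcε _ ((hmono R hR t₀ t h₀ ht).trans ((hlow _ δ hx).trans hδ.le))⟩
  · intro ρ hρ
    refine ⟨max (β₁ (β₂ ρ.toNNReal)) 1, by positivity, fun R hR t₀ t h₀ ht hx => ?_⟩
    have hx' := hlow _ ρ.toNNReal (hx.trans (Real.le_coe_toNNReal ρ))
    exact (hup _ _ ((hmono R hR t₀ t h₀ ht).trans hx')).1.trans (le_max_left _ _)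
  · intro ρ ε hρ hε
    obtain ⟨c, hc, hcε⟩ := hsmall ε hε
    obtain ⟨τ, hτ, H⟩ := exists_time_lyap_le hISS hSG hc (β₂ ρ.toNNReal)
    refine ⟨τ, hτ, fun R hR t₀ t h₀ ht hx => ?_⟩
    exact hcε _ (H R.x t₀ t ht (R.isTrajectory hISS hSG hR h₀)
      (hlow _ ρ.toNNReal (hx.trans (Real.le_coe_toNNReal ρ))))
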